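/- **Stable matching instances.** An instance $I$ consists of finite sets $M$ of men and $W$ of women and a preference list (most preferred first) of members of the other side for each agent. A pair $(m,w)$ is acceptable if each is on the other's list. A matching is a set of acceptable pairs in which each agent occurs at most once. It is stable if there is no acceptable pair $(m,w)$ such that each of $m,w$ is unmatched or prefers the other to its partner. We call $I$ an *SM instance* if no list has repetitions, $a$ lists $b$ if and only if $b$ lists $a$, and every agent is matched in every stable matching. The man-optimal stable matching $\mu_0$ gives each man his best stable partner. **Rotations.** A rotation exposed in a stable matching $\mu$ is a non-empty circular list $\rho=(m_1,w_1),\dots,(m_\ell,w_\ell)$ of distinct pairs of $\mu$ such that for every $i$ (indices mod $\ell$) $w_{i+1}$ is the first woman after $w_i$ on the list of $m_i$ who prefers $m_i$ to her partner in $\mu$. Eliminating $\rho$ from $\mu$ means replacing each $(m_i,w_i)$ by $(m_i,w_{i+1})$. Every stable matching $\mu$ of an SM instance arises from $\mu_0$ by successively eliminating exposed rotations; let $R_\mu$ be the set of rotations eliminated (it depends only on $\mu$). The rotation poset $\mathcal R(I)$ is the set of all rotations exposed in some stable matching of $I$, where $\rho\prec\rho'$ if and only if $\rho\in R_\mu$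 for every stable matching $\mu$ in which $\rho'$ is exposed. **The construction.** Let $\mathcal P=(V,\prec)$ be a finite poset with Hasse diagram $H(\mathcal P)=(V,E)$, where $E$ is the set of pairs $(u,v)$ such that $u\prec v$ and no $z$ satisfies $u\prec z\prec v$. Let $p=|V|$, $q=|E|$, and let $\phi\colon E\to\mathbf Z^+$ be an arbitrary edge colouring. $\mathsf{ConstructInstance}(H(\mathcal P),\phi)$ does the following. 1. For $v\in V$ let $C_v$ be the set of colours of the edges incident to $v$; if $|C_v|<2$, add colours $1$ and/or $2$ so that $|C_v|=2$. Create a man $m_{c,v}$ and a woman $w_{c,v}$ for all $v\in V$, $c\in C_v$, with empty lists. 2. For all $v\in V$ and $c\in C_v$, add $m_{c,v}$ and $w_{c,v}$ to each other's lists. 3. For all $(u,v)\in E$, in any order, with $c=\phi((u,v))$, add $m_{c,v}$ to the front of the list of $w_{c,u}$ and $w_{c,u}$ to the end of the list of $m_{c,v}$. 4. For each $v\in V$ choose any ordering $\pi_v(1),\dots,\pi_v(b_v)$ of $C_v$, where $b_v=|C_v|$, and let $\rho_v$ be the circular list $(m_{\pi_v(1),v},w_{\pi_v(1),v}),\dots,(m_{\pi_v(b_v),v},w_{\pi_v(b_v),v})$.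 For $i=1,\dots,b_v$ (indices mod $b_v$), add $w_{\pi_v(i+1),v}$ to the end of the list of $m_{\pi_v(i),v}$ and $m_{\pi_v(i),v}$ to the front of the list of $w_{\pi_v(i+1),v}$. **Theorem.** For every finite poset $\mathcal P$ and every edge colouring $\phi$ of $H(\mathcal P)$, and for all choices left open in the construction (the padding colours, the order of the edges, the orderings $\pi_v$), the resulting instance $I=I(\mathcal P,\phi)$ is an SM instance, and $v\mapsto\rho_v$ is an isomorphism from $\mathcal P$ onto the rotation poset $\mathcal R(I)$. There is an absolute constant $K$ such that $I$ always has at most $K(p+q)$ agents. Moreover $I$ can be constructed in $O(p+q)$ time: there are a constant $K$ and a fixed program for a unit-cost random access machine (registers and finitely many arrays of natural numbers, initially zero, with addition, truncated subtraction, comparison and indexed access) which, for every $\mathcal P$, every numbering of its vertices, every $\phi$, and every listing of the edges of $H(\mathcal P)$, given $p$, $q$ and the listed edges with their colours, writes out within $K(p+q+1)$ steps the agents and preference lists of an instance produced by $\mathsf{ConstructInstance}(H(\mathcal P),\phi)$ for some such choices. -/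

import Mathlib

namespace RotPoset

/-! ### Stable matching instances with (possibly) incomplete preference lists -/

/-- The data of a stable matching instance whose men have names in `M` and whose women have names
in `W`: the finite sets of men and women, and a preference list (most preferred first) for each
agent.  The lists of names that are not in `men` or `women` play no role. -/
structure SMInstance (M W : Type*) where
  men : Finset M
  women : Finset W
  manPref : M → List W
  womanPref : W → List M

/-- `a` is listed (strictly) before `b` in the preference list `l`. -/
def Prefers {α : Type*} (l : List α) (a b : α) : Prop := [a, b].Sublist l

namespace SMInstance

variable {M W : Type*}

/-- `m` and `w` are agents of the instance and each is in the list of the other. -/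
def Acceptable (I : SMInstance M W) (m : M) (w : W) : Prop :=
  m ∈ I.men ∧ w ∈ I.women ∧ w ∈ I.manPref m ∧ m ∈ I.womanPref w

/-- A matching: a set of acceptable pairs such that each agent is in at most one pair. -/
def IsMatching (I : SMInstance M W) (μ : Set (M × W)) : Prop :=
  (∀ m w, (m, w) ∈ μ → I.Acceptable m w) ∧
  (∀ m w w', (m, w) ∈ μ → (m, w') ∈ μ → w = w') ∧
  (∀ m m' w, (m, w) ∈ μ → (m', w) ∈ μ → m = m')

/-- A blocking pair of `μ`: an acceptable pair, each member of which is unmatched or prefers the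
other to the partner in `μ`. -/
def Blocks (I : SMInstance M W) (μ : Set (M × W)) (m : M) (w : W) : Prop :=
  I.Acceptable m w ∧
  (∀ w', (m, w') ∈ μ → Prefers (I.manPref m) w w') ∧
  (∀ m', (m', w) ∈ μ → Prefers (I.womanPref w) m m')

/-- A stable matching: a matching without a blocking pair. -/
def IsStable (I : SMInstance M W) (μ : Set (M × W)) : Prop :=
  I.IsMatching μ ∧ ∀ m w, ¬ I.Blocks μ m w

/-- The conventions for SM instances: each preference list is a repetition-free list of agents of
the other side, the lists are consistent (`a` lists `b` iff `b` lists `a`), and all agents appear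
in every stable matching. -/
structure IsValid (I : SMInstance M W) : Prop where
  man_nodup : ∀ m ∈ I.men, (I.manPref m).Nodup
  woman_nodup : ∀ w ∈ I.women, (I.womanPref w).Nodup
  man_subset : ∀ m ∈ I.men, ∀ w ∈ I.manPref m, w ∈ I.women
  woman_subset : ∀ w ∈ I.women, ∀ m ∈ I.womanPref w, m ∈ I.men
  consistent : ∀ m ∈ I.men, ∀ w ∈ I.women, w ∈ I.manPref m ↔ m ∈ I.womanPref w
  man_matched : ∀ μ, I.IsStable μ → ∀ m ∈ I.men, ∃ w, (m, w) ∈ μ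
  woman_matched : ∀ μ, I.IsStable μ → ∀ w ∈ I.women, ∃ m, (m, w) ∈ μ

/-- The man-optimal stable matching: every man gets his best stable partner. -/
def IsManOptimal (I : SMInstance M W) (μ : Set (M × W)) : Prop :=
  I.IsStable μ ∧ ∀ μ', I.IsStable μ' → ∀ m w w', (m, w) ∈ μ → (m, w') ∈ μ' →
    w = w' ∨ Prefers (I.manPref m) w w'

end SMInstance

/-! ### Rotations and the rotation poset -/

/-- `y` immediately follows `x` on the circular list `ρ` (on a one-element circular list the
element follows itself). -/
def Follows {α : Type*} (ρ : Cycle α) (x y : α) : Prop :=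
  ∃ l : List α, ρ = ((x :: l : List α) : Cycle α) ∧ (l ++ [x]).head? = some y

namespace SMInstance

variable {M W : Type*}

/-- `ρ` is a rotation exposed in the stable matching `μ`: a non-empty circular list of distinct
pairs of `μ` such that, whenever `(m, w)` is followed by `(m', w')` on `ρ`, the woman `w'` is the
first woman after `w` on the list of `m` who prefers `m` to her partner in `μ` (her partner being
`m'`). -/
def Exposed (I : SMInstance M W) (μ : Set (M × W)) (ρ : Cycle (M × W)) : Prop :=
  I.IsStable μ ∧ ρ ≠ Cycle.nil ∧ ρ.Nodup ∧ (∀ x ∈ ρ, x ∈ μ) ∧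
  ∀ m w m' w', Follows ρ (m, w) (m', w') →
    Prefers (I.manPref m) w w' ∧ Prefers (I.womanPref w') m m' ∧
    ∀ m'' w'', Prefers (I.manPref m) w w'' → Prefers (I.manPref m) w'' w' → (m'', w'') ∈ μ →
      ¬ Prefers (I.womanPref w'') m m''

/-- The elimination `μ \ ρ`: the pairs `(mᵢ, wᵢ)` on `ρ` are replaced by `(mᵢ, wᵢ₊₁)`. -/
def eliminate (μ : Set (M × W)) (ρ : Cycle (M × W)) : Set (M × W) :=
  (μ \ {x | x ∈ ρ}) ∪ {z | ∃ x y, Follows ρ x y ∧ z = (x.1, y.2)}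

/-- `I.Reaches μ R`: the matching `μ` arises from the man-optimal stable matching by successively
eliminating exposed rotations, and `R` is the set of the rotations eliminated on the way. -/
inductive Reaches (I : SMInstance M W) : Set (M × W) → Set (Cycle (M × W)) → Prop
  | start (μ : Set (M × W)) (h : I.IsManOptimal μ) : Reaches I μ ∅
  | step (μ : Set (M × W)) (R : Set (Cycle (M × W))) (ρ : Cycle (M × W))
      (h : Reaches I μ R) (hρ : I.Exposed μ ρ) : Reaches I (eliminate μ ρ) (insert ρ R)

/-- The set of all rotations exposed in some stable matching of `I`. -/
def rotations (I : SMInstance M W) : Set (Cycle (M × W)) := {ρ | ∃ μ, I.Exposed μ ρ}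

/-- The strict order of the rotation poset: `ρ` precedes `ρ'` if `ρ` has been eliminated in every
stable matching in which `ρ'` is exposed. -/
def Precedes (I : SMInstance M W) (ρ ρ' : I.rotations) : Prop :=
  ∀ μ, I.Exposed μ ρ'.1 → ∃ R, I.Reaches μ R ∧ ρ.1 ∈ R

end SMInstance

/-! ### The construction -/

/-- The (directed) edges of the Hasse diagram of a poset: the covering pairs. -/
def HasseEdge (V : Type*) [PartialOrder V] : Type _ := {e : V × V // e.1 ⋖ e.2}

namespace HasseEdge

variable {V : Type*} [PartialOrder V]

/-- The lower endpoint `u` of the edge `(u, v)`. -/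
def src (e : HasseEdge V) : V := e.1.1

/-- The upper endpoint `v` of the edge `(u, v)`. -/
def tgt (e : HasseEdge V) : V := e.1.2

end HasseEdge

/-- A man `m_{c,v}` or a woman `w_{c,v}` is named by the pair `(c, v)`. -/
abbrev Name (V : Type*) : Type _ := ℕ+ × V

/-- The colours of the edges incident to `v`. -/
def incidentColours {V : Type*} [PartialOrder V] (φ : HasseEdge V → ℕ+) (v : V) : Set ℕ+ :=
  {c | ∃ e : HasseEdge V, (e.src = v ∨ e.tgt = v) ∧ φ e = c}

/-- The choices that the construction leaves open: the order in which the edges are processed,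
the colours `1` and/or `2` added to those `C v` that have fewer than two colours, and the ordering
of each `C v`. -/
structure Choices {V : Type*} [PartialOrder V] (φ : HasseEdge V → ℕ+) where
  edges : List (HasseEdge V)
  edges_nodup : edges.Nodup
  mem_edges : ∀ e, e ∈ edges
  C : V → Finset ℕ+
  C_eq : ∀ v, 2 ≤ (incidentColours φ v).ncard → (C v : Set ℕ+) = incidentColours φ v
  C_pad : ∀ v, (incidentColours φ v).ncard < 2 →
    incidentColours φ v ⊆ C v ∧ (C v : Set ℕ+) ⊆ incidentColours φ v ∪ {1, 2} ∧ (C v).card = 2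
  ord : V → List ℕ+
  ord_nodup : ∀ v, (ord v).Nodup
  mem_ord : ∀ v c, c ∈ ord v ↔ c ∈ C v

namespace SMInstance

variable {M W : Type*}

/-- Add `w` to the end of the preference list of `m`. -/
def manAppend [DecidableEq M] (I : SMInstance M W) (m : M) (w : W) : SMInstance M W :=
  { I with manPref := Function.update I.manPref m (I.manPref m ++ [w]) }

/-- Add `m` to the front of the preference list of `w`. -/
def womanPrepend [DecidableEq W] (I : SMInstance M W) (w : W) (m : M) : SMInstance M W :=
  { I with womanPref := Function.update I.womanPref w (m :: I.womanPref w) }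

end SMInstance

section Construction

variable {V : Type*} [PartialOrder V] [DecidableEq V] {φ : HasseEdge V → ℕ+} {p : ℕ}

/-- The names `(c, v)` with `c ∈ C v`. -/
def names (lab : Fin p ≃ V) (ch : Choices φ) : Finset (Name V) :=
  Finset.univ.biUnion fun i => (ch.C (lab i)).image fun c => (c, lab i)

/-- The agents, with empty preference lists. -/
def initInstance (lab : Fin p ≃ V) (ch : Choices φ) : SMInstance (Name V) (Name V) where
  men := names lab ch
  women := names lab ch
  manPref _ := []
  womanPref _ := []

/-- First loop: `m_{c,v}` and `w_{c,v}` are added to each other's lists. -/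
def addManOptimal (lab : Fin p ≃ V) (ch : Choices φ) (I : SMInstance (Name V) (Name V)) :
    SMInstance (Name V) (Name V) :=
  (List.finRange p).foldl (fun I i =>
    (ch.ord (lab i)).foldl (fun I c =>
      (I.manAppend (c, lab i) (c, lab i)).womanPrepend (c, lab i) (c, lab i)) I) I

/-- Second loop: for each edge `(u, v)` of colour `c`, the man `m_{c,v}` is added to the front of
the list of `w_{c,u}`, and `w_{c,u}` to the end of the list of `m_{c,v}`. -/
def addEdges (ch : Choices φ) (I : SMInstance (Name V) (Name V)) : SMInstance (Name V) (Name V) :=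
  ch.edges.foldl (fun I e =>
    (I.womanPrepend (φ e, e.src) (φ e, e.tgt)).manAppend (φ e, e.tgt) (φ e, e.src)) I

/-- Third loop: for each `v` and each pair `(c, c⁺)` of cyclically consecutive colours in the
ordering of `C v`, the woman `w_{c⁺,v}` is added to the end of the list of `m_{c,v}`, and `m_{c,v}`
to the front of the list of `w_{c⁺,v}`. -/
def addWomanOptimal (lab : Fin p ≃ V) (ch : Choices φ) (I : SMInstance (Name V) (Name V)) :
    SMInstance (Name V) (Name V) :=
  (List.finRange p).foldl (fun I i =>
    ((ch.ord (lab i)).zip ((ch.ord (lab i)).rotate 1)).foldl (fun I cc =>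
      (I.manAppend (cc.1, lab i) (cc.2, lab i)).womanPrepend (cc.2, lab i) (cc.1, lab i)) I) I

/-- `ConstructInstance`, for the vertices numbered by `lab` and the given choices. -/
def constructInstance (lab : Fin p ≃ V) (ch : Choices φ) : SMInstance (Name V) (Name V) :=
  addWomanOptimal lab ch (addEdges ch (addManOptimal lab ch (initInstance lab ch)))

/-- The circular list `ρ_v = (m_{π(1),v}, w_{π(1),v}), …, (m_{π(b),v}, w_{π(b),v})`, where `π` is
the ordering of `C v`. -/
def rho (ch : Choices φ) (v : V) : Cycle (Name V × Name V) :=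
  (((ch.ord v).map fun c => ((c, v), (c, v)) : List (Name V × Name V)) : Cycle (Name V × Name V))

end Construction

/-! ### A unit-cost random access machine

Structured programs over registers and finitely many arrays of natural numbers.  The only
arithmetic is addition, truncated subtraction and comparison; an array cell is accessed at a
computed index.  Every node of an expression, every statement and every test costs one step. -/

/-- The contents of the registers `reg x`, of the array cells `arr a i`, and the output that has
been written so far. -/
structure State where
  reg : ℕ → ℕ
  arr : ℕ → ℕ → ℕ
  out : List ℕ

inductive Expr where
  | const (n : ℕ)
  | reg (x : ℕ)
  | arr (a : ℕ) (i : Expr)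
  | add (e f : Expr)
  | sub (e f : Expr)
  | lt (e f : Expr)
  | eq (e f : Expr)

namespace Expr

def eval (s : State) : Expr → ℕ
  | const n => n
  | reg x => s.reg x
  | arr a i => s.arr a (i.eval s)
  | add e f => e.eval s + f.eval s
  | sub e f => e.eval s - f.eval s
  | lt e f => if e.eval s < f.eval s then 1 else 0
  | eq e f => if e.eval s = f.eval s then 1 else 0

/-- The number of nodes. -/
def cost : Expr → ℕ
  | const _ => 1
  | reg _ => 1
  | arr _ i => i.cost + 1
  | add e f => e.cost + f.cost + 1
  | sub e f => e.cost + f.cost + 1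
  | lt e f => e.cost + f.cost + 1
  | eq e f => e.cost + f.cost + 1

end Expr

/-- `cond e P Q` runs `P` if `e` is non-zero and `Q` otherwise; `loop e P` runs `P` as long as `e`
is non-zero; `emit e` writes the value of `e` to the end of the output. -/
inductive Program where
  | skip
  | assign (x : ℕ) (e : Expr)
  | store (a : ℕ) (i e : Expr)
  | emit (e : Expr)
  | seq (P Q : Program)
  | cond (e : Expr) (P Q : Program)
  | loop (e : Expr) (P : Program)

/-- `Runs P s t s'`: started in state `s`, the program `P` halts after exactly `t` steps, in state
`s'`. -/
inductive Runs : Program → State → ℕ → State → Prop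
  | skip (s : State) : Runs .skip s 1 s
  | assign (x : ℕ) (e : Expr) (s : State) :
      Runs (.assign x e) s (e.cost + 1) { s with reg := Function.update s.reg x (e.eval s) }
  | store (a : ℕ) (i e : Expr) (s : State) :
      Runs (.store a i e) s (i.cost + e.cost + 1)
        { s with arr := Function.update s.arr a
                  (Function.update (s.arr a) (i.eval s) (e.eval s)) }
  | emit (e : Expr) (s : State) :
      Runs (.emit e) s (e.cost + 1) { s with out := s.out ++ [e.eval s] }
  | seq (P Q : Program) (s s' s'' : State) (t t' : ℕ) (hP : Runs P s t s') (hQ : Runs Q s' t' s'') :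
      Runs (.seq P Q) s (t + t') s''
  | condTrue (e : Expr) (P Q : Program) (s s' : State) (t : ℕ) (he : e.eval s ≠ 0)
      (hP : Runs P s t s') : Runs (.cond e P Q) s (e.cost + 1 + t) s'
  | condFalse (e : Expr) (P Q : Program) (s s' : State) (t : ℕ) (he : e.eval s = 0)
      (hQ : Runs Q s t s') : Runs (.cond e P Q) s (e.cost + 1 + t) s'
  | loopTrue (e : Expr) (P : Program) (s s' s'' : State) (t t' : ℕ) (he : e.eval s ≠ 0)
      (hP : Runs P s t s') (hL : Runs (.loop e P) s' t' s'') :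
      Runs (.loop e P) s (e.cost + 1 + t + t') s''
  | loopFalse (e : Expr) (P : Program) (s : State) (he : e.eval s = 0) :
      Runs (.loop e P) s (e.cost + 1) s

/-- The initial state: the input is in the array number `0`, everything else is zero. -/
def initState (input : List ℕ) : State where
  reg _ := 0
  arr a i := if a = 0 then input.getD i 0 else 0
  out := []

/-- On the given input the program halts with the given output after at most `T` steps. -/
def ComputesWithin (P : Program) (input output : List ℕ) (T : ℕ) : Prop :=
  ∃ t s, Runs P (initState input) t s ∧ t ≤ T ∧ s.out = output

/-! ### Input and output formats -/

section Encoding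

variable {V : Type*} [PartialOrder V] {p : ℕ}

/-- The input: `p`, `q`, and for each edge `(u, v)`, in the listed order, the numbers of `u` and
`v` and the colour.  The vertices are numbered `0, …, p - 1`. -/
def encodeInput (lab : Fin p ≃ V) (φ : HasseEdge V → ℕ+) (edges : List (HasseEdge V)) : List ℕ :=
  p :: edges.length ::
    edges.flatMap fun e => [(lab.symm e.src : ℕ), (lab.symm e.tgt : ℕ), (φ e : ℕ)]

/-- The agent named `(c, v)` is written as the two numbers `c` and `v`. -/
def encodeName (lab : Fin p ≃ V) (a : Name V) : List ℕ := [(a.1 : ℕ), (lab.symm a.2 : ℕ)]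

/-- An agent with a preference list: the agent, the length of the list, the list. -/
def encodeList (lab : Fin p ≃ V) (a : Name V) (l : List (Name V)) : List ℕ :=
  encodeName lab a ++ l.length :: l.flatMap (encodeName lab)

/-- `out` describes `I`: the numbers of men and of women, then each man with his preference list,
then each woman with her preference list, the men and the women being enumerated in any order. -/
def EncodesInstance (lab : Fin p ≃ V) (I : SMInstance (Name V) (Name V)) (out : List ℕ) : Prop :=
  ∃ ms ws : List (Name V), ms.Nodup ∧ (∀ a, a ∈ ms ↔ a ∈ I.men) ∧
    ws.Nodup ∧ (∀ a, a ∈ ws ↔ a ∈ I.women) ∧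
    out = ms.length :: ws.length ::
      (ms.flatMap (fun m => encodeList lab m (I.manPref m)) ++
        ws.flatMap (fun w => encodeList lab w (I.womanPref w)))

end Encoding

end RotPoset

/-!
The proof has two parts.

**The rotation poset.**  The preference lists are obtained by filtering one list of insertions
(`insertPairs_spec`).  With `succColour` for the cyclic successor on the colours of a vertex, the
man `m_{c,v}` has the list `w_{c,v}`, then the women `w_{c,u}` of the edges `(u, v)` of colour `c`,
then the next woman of `v`; dually, the woman `w_{c,v}` has the preceding man of `v` first and
`m_{c,v}` last.  For a set `D` of vertices let `matchingOf ch D` give the men of the vertices in `D`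
their last choices and all others their first choices.  The stable matchings are exactly those with
`D` a lower set (`isStable_iff`): the pair `(m_{c,v}, w_{c,u})` of an edge blocks if and only if
`v ∈ D` and `u ∉ D`.  That there are no others is a counting argument: in a stable matching, the
first choices of the men who do not get their first choice are matched among these men, which
defines a permutation of these men; along it the vertex never decreases, hence it is constant
(`succ_mem_of_isStable`).  The same argument around a rotation shows that only the `ρ_v` can be
exposed, and `ρ_v` is exposed in the matching of `D` if and only if `v ∉ D` and all `u < v` are in
`D` (`exposed_iff`).  Eliminating it gives the matching of `insert v D`, so the rotations eliminated
on the way to the matching of `D` are the `ρ_v` with `v ∈ D`, and `ρ_u` precedes `ρ_v` if and only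
if `u < v` (`exists_relIso`).

**The running time.**  With `B` larger than all colours, the program addresses the pair of a vertex
`v` and a colour `c` by the key `v * B + c`; the multiples of `B` are tabulated by repeated
addition.  The array indexed by keys starts out as zero, so the colours at each vertex can be
collected without sorting, and the edges of each agent are kept in linked lists.  Programs are
verified with a weakest-precondition predicate `Wp`, whose loop rule lets the invariant speak of the
steps used so far, and with the fact that a program changes only what it writes to (`Runs.frame`).
The time for writing the output is linear in the length of the output and in `p`, and each edge
occurs in the list of one man and in the list of one woman (`sum_length_filter_le`).  The constants
in the step bounds are generous.
-/

namespace RotPoset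

/-! ### Preference lists -/

section Prefers

variable {α : Type*}

theorem Prefers.mem_left {l : List α} {a b : α} (h : Prefers l a b) : a ∈ l :=
  h.subset (by simp)

theorem Prefers.mem_right {l : List α} {a b : α} (h : Prefers l a b) : b ∈ l :=
  h.subset (by simp)

theorem prefers_cons_of_mem {a b : α} {l : List α} (h : b ∈ l) : Prefers (a :: l) a b :=
  (List.singleton_sublist.2 h).cons_cons a

theorem prefers_concat_of_mem {a b : α} {l : List α} (h : a ∈ l) : Prefers (l ++ [b]) a b :=
  (List.singleton_sublist.2 h).append (List.Sublist.refl [b])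

theorem not_prefers_head {a b : α} {l : List α} (h : (a :: l).Nodup) : ¬ Prefers (a :: l) b a := by
  intro hp
  rcases List.sublist_cons_iff.1 hp with h' | ⟨r, hr, h'⟩
  · exact (List.nodup_cons.1 h).1 (h'.subset (by simp))
  · obtain ⟨rfl, rfl⟩ := List.cons.inj hr
    exact (List.nodup_cons.1 h).1 (h'.subset (by simp))

theorem not_prefers_last {a b : α} {l : List α} (h : (l ++ [a]).Nodup) :
    ¬ Prefers (l ++ [a]) a b := by
  intro hp
  have hp' : Prefers (a :: l.reverse) b a := by
    have := List.reverse_sublist.2 hp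
    simpa [Prefers] using this
  exact not_prefers_head (by simpa using List.nodup_reverse.2 h) hp'

end Prefers

/-! ### The instance as the result of a sequence of insertions -/

section Insertion

variable {M W : Type*} [DecidableEq M] [DecidableEq W]

/-- Each pair `(m, w)` of the list is processed in turn: `w` is added to the end of the list of `m`
and `m` to the front of the list of `w`. -/
def insertPairs (I : SMInstance M W) (l : List (M × W)) : SMInstance M W :=
  l.foldl (fun I x => (I.manAppend x.1 x.2).womanPrepend x.2 x.1) I

theorem insertPairs_append (I : SMInstance M W) (l l' : List (M × W)) :
    insertPairs (insertPairs I l) l' = insertPairs I (l ++ l') := by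
  simp [insertPairs]

theorem insertPairs_spec (I : SMInstance M W) (l : List (M × W)) :
    (insertPairs I l).men = I.men ∧ (insertPairs I l).women = I.women ∧
    (∀ m, (insertPairs I l).manPref m =
      I.manPref m ++ (l.filter fun x => x.1 = m).map Prod.snd) ∧
    (∀ w, (insertPairs I l).womanPref w =
      ((l.filter fun x => x.2 = w).map Prod.fst).reverse ++ I.womanPref w) := by
  induction l generalizing I with
  | nil => simp [insertPairs]
  | cons x l ih =>
    obtain ⟨h1, h2, h3, h4⟩ := ih ((I.manAppend x.1 x.2).womanPrepend x.2 x.1)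
    refine ⟨h1, h2, fun m => (h3 m).trans ?_, fun w => (h4 w).trans ?_⟩
    · by_cases hm : x.1 = m
      · subst hm; simp [SMInstance.manAppend, SMInstance.womanPrepend]
      · simp [SMInstance.manAppend, SMInstance.womanPrepend, hm, Function.update_of_ne (Ne.symm hm)]
    · by_cases hw : x.2 = w
      · subst hw; simp [SMInstance.manAppend, SMInstance.womanPrepend]
      · simp [SMInstance.manAppend, SMInstance.womanPrepend, hw, Function.update_of_ne (Ne.symm hw)]

end Insertion

/-! ### Lists without repetitions -/

theorem flatMap_eq_of_nodup {α β : Type*} {l : List α} {f : α → List β} {a : α} (hl : l.Nodup)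
    (ha : a ∈ l) (hf : ∀ b, b ≠ a → f b = []) : l.flatMap f = f a := by
  induction l with
  | nil => simp at ha
  | cons x l ih =>
    obtain ⟨hx, hl⟩ := List.nodup_cons.1 hl
    rw [List.flatMap_cons]
    rcases List.mem_cons.1 ha with rfl | ha
    · have : l.flatMap f = [] :=
        List.flatMap_eq_nil_iff.2 fun b hb => hf b fun h => hx (h ▸ hb)
      simp [this]
    · rw [hf x fun h => hx (h ▸ ha), ih hl ha, List.nil_append]

theorem filter_eq_singleton_of_nodup {α : Type*} {l : List α} {p : α → Bool} {a : α}
    (hl : l.Nodup) (ha : a ∈ l) (hp : ∀ b ∈ l, p b = true ↔ b = a) : l.filter p = [a] := by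
  induction l with
  | nil => simp at ha
  | cons x l ih =>
    obtain ⟨hx, hl⟩ := List.nodup_cons.1 hl
    rcases List.mem_cons.1 ha with rfl | ha
    · rw [List.filter_cons_of_pos ((hp a (by simp)).2 rfl), List.filter_eq_nil_iff.2]
      intro b hb h
      exact hx ((hp b (by simp [hb])).1 h ▸ hb)
    · rw [List.filter_cons_of_neg, ih hl ha fun b hb => hp b (by simp [hb])]
      intro h
      exact hx ((hp x (by simp)).1 h ▸ ha)

theorem zip_rotate_one {α : Type*} [DecidableEq α] {l : List α} (hl : l.Nodup) :
    l.zip (l.rotate 1) = l.map fun c => (c, l.formPerm c) := by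
  refine List.ext_getElem (by simp) fun i h1 h2 => ?_
  simp [List.getElem_rotate, List.formPerm_apply_getElem l hl]

/-- A property that passes from each member of a list to the cyclically next one holds for all
members if it holds for one. -/
theorem formPerm_induction {α : Type*} [DecidableEq α] {l : List α} (hl : l.Nodup) {P : α → Prop}
    (hP : ∀ a ∈ l, P a → P (l.formPerm a)) {a b : α} (ha : a ∈ l) (h : P a) (hb : b ∈ l) : P b := by
  have hcyc := hl.isCycleOn_formPerm
  have hset : {a | a ∈ l} = (l.toFinset : Set α) := by ext; simp
  rw [hset] at hcyc
  obtain ⟨n, -, rfl⟩ := hcyc.exists_pow_eq (List.mem_toFinset.2 ha) (List.mem_toFinset.2 hb)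
  clear hb
  suffices ∀ n : ℕ, (l.formPerm ^ n) a ∈ l ∧ P ((l.formPerm ^ n) a) from (this n).2
  intro n
  induction n with
  | zero => exact ⟨ha, h⟩
  | succ n ih =>
    rw [pow_succ', Equiv.Perm.mul_apply]
    exact ⟨List.formPerm_apply_mem_of_mem ih.1, hP _ ih.1 ih.2⟩

/-! ### The preference lists of the constructed instance -/

section Construction

variable {V : Type*} [PartialOrder V] {φ : HasseEdge V → ℕ+} {p : ℕ}

theorem HasseEdge.covBy (e : HasseEdge V) : e.src ⋖ e.tgt := e.2

theorem HasseEdge.eq_of_src_tgt {e e' : HasseEdge V} (h : e.src = e'.src) (h' : e.tgt = e'.tgt) :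
    e = e' := Subtype.ext (Prod.ext h h')

theorem Choices.incident_subset (ch : Choices φ) (v : V) :
    incidentColours φ v ⊆ (ch.C v : Set ℕ+) := by
  rcases le_or_gt 2 (incidentColours φ v).ncard with h | h
  · exact (ch.C_eq v h).ge
  · exact (ch.C_pad v h).1

theorem Choices.two_le_card (ch : Choices φ) (v : V) : 2 ≤ (ch.C v).card := by
  rcases le_or_gt 2 (incidentColours φ v).ncard with h | h
  · rwa [← Set.ncard_coe_finset, ch.C_eq v h]
  · exact (ch.C_pad v h).2.2.ge

theorem Choices.ord_toFinset (ch : Choices φ) (v : V) : (ch.ord v).toFinset = ch.C v := by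
  ext c; simp [ch.mem_ord]

theorem Choices.length_ord (ch : Choices φ) (v : V) : (ch.ord v).length = (ch.C v).card := by
  rw [← ch.ord_toFinset, List.toFinset_card_of_nodup (ch.ord_nodup v)]

theorem Choices.colour_mem_src (ch : Choices φ) (e : HasseEdge V) : φ e ∈ ch.C e.src :=
  ch.incident_subset _ ⟨e, Or.inl rfl, rfl⟩

theorem Choices.colour_mem_tgt (ch : Choices φ) (e : HasseEdge V) : φ e ∈ ch.C e.tgt :=
  ch.incident_subset _ ⟨e, Or.inr rfl, rfl⟩

/-- The cyclic successor on the colours of `v`; it fixes all other colours. -/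
def succColour (ch : Choices φ) (v : V) : Equiv.Perm ℕ+ := (ch.ord v).formPerm

theorem succColour_mem {ch : Choices φ} {v : V} {c : ℕ+} :
    succColour ch v c ∈ ch.C v ↔ c ∈ ch.C v := by
  simp only [← ch.mem_ord]; exact List.formPerm_mem_iff_mem

theorem succColour_symm_mem {ch : Choices φ} {v : V} {c : ℕ+} :
    (succColour ch v).symm c ∈ ch.C v ↔ c ∈ ch.C v := by
  rw [← succColour_mem, Equiv.apply_symm_apply]

theorem succColour_ne {ch : Choices φ} {v : V} {c : ℕ+} (hc : c ∈ ch.C v) :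
    succColour ch v c ≠ c := by
  refine (List.formPerm_apply_mem_ne_self_iff _ (ch.ord_nodup v) c ((ch.mem_ord v c).2 hc)).2 ?_
  rw [ch.length_ord]; exact ch.two_le_card v

/-- A property of colours that the cyclic successor preserves holds on all of `C v` if it holds
somewhere on `C v`. -/
theorem succColour_induction {ch : Choices φ} {v : V} {P : ℕ+ → Prop}
    (hP : ∀ c ∈ ch.C v, P c → P (succColour ch v c)) {c d : ℕ+} (hc : c ∈ ch.C v) (h : P c)
    (hd : d ∈ ch.C v) : P d := by
  simp only [← ch.mem_ord] at hP hc hd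
  exact formPerm_induction (ch.ord_nodup v) hP hc h hd

variable [DecidableEq V]

/-- The pairs inserted into the preference lists, in the order of their insertion. -/
def insertedPairs (lab : Fin p ≃ V) (ch : Choices φ) : List (Name V × Name V) :=
  ((List.finRange p).flatMap fun i => (ch.ord (lab i)).map fun c => ((c, lab i), (c, lab i))) ++
  (ch.edges.map fun e => ((φ e, e.tgt), (φ e, e.src))) ++
  ((List.finRange p).flatMap fun i => (ch.ord (lab i)).map fun c =>
    ((c, lab i), (succColour ch (lab i) c, lab i)))

theorem constructInstance_eq (lab : Fin p ≃ V) (ch : Choices φ) :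
    constructInstance lab ch = insertPairs (initInstance lab ch) (insertedPairs lab ch) := by
  have h1 : ∀ I, addManOptimal lab ch I = insertPairs I ((List.finRange p).flatMap fun i =>
      (ch.ord (lab i)).map fun c => ((c, lab i), (c, lab i))) := by
    intro I
    simp only [addManOptimal, insertPairs, List.foldl_flatMap, List.foldl_map]
  have h2 : ∀ I, addEdges ch I =
      insertPairs I (ch.edges.map fun e => ((φ e, e.tgt), (φ e, e.src))) := by
    intro I
    simp only [addEdges, insertPairs, List.foldl_map]
    rfl
  have h3 : ∀ I, addWomanOptimal lab ch I = insertPairs I ((List.finRange p).flatMap fun i =>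
      (ch.ord (lab i)).map fun c => ((c, lab i), (succColour ch (lab i) c, lab i))) := by
    intro I
    simp only [addWomanOptimal, insertPairs, List.foldl_flatMap, List.foldl_map,
      zip_rotate_one (ch.ord_nodup _), succColour]
  rw [constructInstance, h1, h2, h3, insertPairs_append, insertPairs_append, insertedPairs,
    List.append_assoc]

theorem mem_names {lab : Fin p ≃ V} {ch : Choices φ} {a : Name V} :
    a ∈ names lab ch ↔ a.1 ∈ ch.C a.2 := by
  obtain ⟨c, v⟩ := a
  simp only [names, Finset.mem_biUnion, Finset.mem_univ, true_and, Finset.mem_image, Prod.mk.injEq]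
  constructor
  · rintro ⟨i, c, hc, rfl, rfl⟩; exact hc
  · intro h; exact ⟨lab.symm v, c, by simpa using h, rfl, by simp⟩

variable (lab : Fin p ≃ V) (ch : Choices φ)

theorem men_eq : (constructInstance lab ch).men = names lab ch := by
  rw [constructInstance_eq]; exact (insertPairs_spec _ _).1

theorem women_eq : (constructInstance lab ch).women = names lab ch := by
  rw [constructInstance_eq]; exact (insertPairs_spec _ _).2.1

/-- The edges of colour `c` into `v`, in the order of their insertion. -/
def inEdges (c : ℕ+) (v : V) : List (HasseEdge V) :=
  ch.edges.filter fun e => e.tgt = v ∧ φ e = c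

/-- The edges of colour `c` out of `v`, in the order of their insertion. -/
def outEdges (c : ℕ+) (v : V) : List (HasseEdge V) :=
  ch.edges.filter fun e => e.src = v ∧ φ e = c

theorem mem_inEdges {c : ℕ+} {v : V} {e : HasseEdge V} :
    e ∈ inEdges ch c v ↔ e.tgt = v ∧ φ e = c := by simp [inEdges, ch.mem_edges]

theorem mem_outEdges {c : ℕ+} {v : V} {e : HasseEdge V} :
    e ∈ outEdges ch c v ↔ e.src = v ∧ φ e = c := by simp [outEdges, ch.mem_edges]

theorem manPref_eq {c : ℕ+} {v : V} (hc : c ∈ ch.C v) :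
    (constructInstance lab ch).manPref (c, v) =
      (c, v) :: ((inEdges ch c v).map fun e => (c, e.src)) ++ [(succColour ch v c, v)] := by
  have hn := List.nodup_finRange p
  have hord := (ch.mem_ord v c).2 hc
  rw [constructInstance_eq, (insertPairs_spec _ _).2.2.1, insertedPairs, List.filter_append,
    List.filter_append, List.filter_flatMap, List.filter_flatMap,
    flatMap_eq_of_nodup hn (List.mem_finRange (lab.symm v)),
    flatMap_eq_of_nodup hn (List.mem_finRange (lab.symm v))]
  · simp only [List.filter_map, Equiv.apply_symm_apply]
    rw [filter_eq_singleton_of_nodup (a := c) (ch.ord_nodup v) hord,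
      filter_eq_singleton_of_nodup (a := c) (ch.ord_nodup v) hord]
    · have : ch.edges.filter ((fun x : Name V × Name V => decide (x.1 = (c, v))) ∘
          fun e => ((φ e, e.tgt), (φ e, e.src))) = inEdges ch c v := by
        refine List.filter_congr fun e _ => ?_
        simp [and_comm]
      rw [this]
      simp only [initInstance, List.map_append, List.map_map, List.nil_append, List.map_cons,
        List.map_nil, List.cons_append, List.cons.injEq, true_and]
      congr 1
      refine List.map_congr_left fun e he => ?_
      simp [((mem_inEdges ch).1 he).2]
    · simp
    · simp
  · intro i hi
    have : ¬ lab i = v := fun h => hi (by simp [← h])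
    simp [List.filter_map, Function.comp_def, this]
  · intro i hi
    have : ¬ lab i = v := fun h => hi (by simp [← h])
    simp [List.filter_map, Function.comp_def, this]

theorem womanPref_eq {c : ℕ+} {v : V} (hc : c ∈ ch.C v) :
    (constructInstance lab ch).womanPref (c, v) =
      ((succColour ch v).symm c, v) ::
        ((outEdges ch c v).reverse.map fun e => (c, e.tgt)) ++ [(c, v)] := by
  have hn := List.nodup_finRange p
  have hord := (ch.mem_ord v c).2 hc
  have hord' := (ch.mem_ord v _).2 (succColour_symm_mem.2 hc)
  rw [constructInstance_eq, (insertPairs_spec _ _).2.2.2, insertedPairs, List.filter_append,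
    List.filter_append, List.filter_flatMap, List.filter_flatMap,
    flatMap_eq_of_nodup hn (List.mem_finRange (lab.symm v)),
    flatMap_eq_of_nodup hn (List.mem_finRange (lab.symm v))]
  · simp only [List.filter_map, Equiv.apply_symm_apply]
    rw [filter_eq_singleton_of_nodup (a := c) (ch.ord_nodup v) hord,
      filter_eq_singleton_of_nodup (a := (succColour ch v).symm c) (ch.ord_nodup v) hord']
    · have : ch.edges.filter ((fun x : Name V × Name V => decide (x.2 = (c, v))) ∘
          fun e => ((φ e, e.tgt), (φ e, e.src))) = outEdges ch c v := by
        refine List.filter_congr fun e _ => ?_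
        simp [and_comm]
      rw [this]
      simp only [initInstance, List.map_append, List.map_map, List.map_cons, List.append_nil,
        List.map_nil, List.cons_append, List.cons.injEq, true_and, List.reverse_append,
        List.reverse_cons, List.reverse_nil, List.nil_append]
      congr 1
      rw [← List.map_reverse]
      refine List.map_congr_left fun e he => ?_
      simp [((mem_outEdges ch).1 (List.mem_reverse.1 he)).2]
    · simp [Equiv.eq_symm_apply]
    · simp
  · intro i hi
    have : ¬ lab i = v := fun h => hi (by simp [← h])
    simp [List.filter_map, Function.comp_def, this]
  · intro i hi
    have : ¬ lab i = v := fun h => hi (by simp [← h])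
    simp [List.filter_map, Function.comp_def, this]

theorem manPref_nodup {c : ℕ+} {v : V} (hc : c ∈ ch.C v) :
    ((constructInstance lab ch).manPref (c, v)).Nodup := by
  have hlt : ∀ e ∈ inEdges ch c v, e.src ≠ v := fun e he h =>
    absurd (e.covBy.lt) (by rw [h, ((mem_inEdges ch).1 he).1]; exact lt_irrefl v)
  rw [manPref_eq lab ch hc, List.cons_append, List.nodup_cons, List.nodup_append]
  refine ⟨?_, ?_, by simp, ?_⟩
  · simp only [List.mem_append, List.mem_map, Prod.mk.injEq, true_and, List.mem_singleton,
      and_true, not_or, not_exists, not_and]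
    exact ⟨hlt, fun h => succColour_ne hc h.symm⟩
  · refine List.Nodup.map_on ?_ (ch.edges_nodup.filter _)
    intro e he e' he' h
    refine HasseEdge.eq_of_src_tgt (Prod.mk.inj h).2 ?_
    rw [((mem_inEdges ch).1 he).1, ((mem_inEdges ch).1 he').1]
  · simp only [List.mem_map, List.mem_singleton]
    rintro _ ⟨e, he, rfl⟩ _ rfl h
    exact hlt e he (Prod.mk.inj h).2

theorem womanPref_nodup {c : ℕ+} {v : V} (hc : c ∈ ch.C v) :
    ((constructInstance lab ch).womanPref (c, v)).Nodup := by
  have hlt : ∀ e ∈ outEdges ch c v, e.tgt ≠ v := fun e he h =>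
    absurd (e.covBy.lt) (by rw [h, ((mem_outEdges ch).1 he).1]; exact lt_irrefl v)
  rw [womanPref_eq lab ch hc, List.cons_append, List.nodup_cons, List.nodup_append]
  refine ⟨?_, ?_, by simp, ?_⟩
  · simp only [List.mem_append, List.mem_map, Prod.mk.injEq, List.mem_singleton, List.mem_reverse,
      and_true, not_or, not_exists, not_and]
    refine ⟨fun e he _ => hlt e he, fun h => succColour_ne hc ?_⟩
    rw [eq_comm, ← Equiv.symm_apply_eq]; exact h
  · refine List.Nodup.map_on ?_ (List.nodup_reverse.2 (ch.edges_nodup.filter _))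
    intro e he e' he' h
    refine HasseEdge.eq_of_src_tgt ?_ (Prod.mk.inj h).2
    rw [((mem_outEdges ch).1 (List.mem_reverse.1 he)).1,
      ((mem_outEdges ch).1 (List.mem_reverse.1 he')).1]
  · simp only [List.mem_map, List.mem_singleton, List.mem_reverse]
    rintro _ ⟨e, he, rfl⟩ _ rfl h
    exact hlt e he (Prod.mk.inj h).2

/-- The three kinds of acceptable pairs. -/
theorem mem_manPref {c : ℕ+} {v : V} (hc : c ∈ ch.C v) {b : Name V} :
    b ∈ (constructInstance lab ch).manPref (c, v) ↔
      b = (c, v) ∨ (∃ e : HasseEdge V, e.tgt = v ∧ φ e = c ∧ b = (c, e.src)) ∨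
        b = (succColour ch v c, v) := by
  rw [manPref_eq lab ch hc]
  simp only [List.cons_append, List.mem_cons, List.mem_append, List.mem_map, mem_inEdges,
    List.not_mem_nil, or_false]
  simp only [and_assoc, eq_comm (b := b)]

theorem mem_manPref_iff_mem_womanPref (a b : Name V) :
    b ∈ (constructInstance lab ch).manPref a ↔ a ∈ (constructInstance lab ch).womanPref b := by
  rw [constructInstance_eq, (insertPairs_spec _ _).2.2.1, (insertPairs_spec _ _).2.2.2]
  simp [initInstance]

theorem mem_manPref_colour {a b : Name V} (ha : a.1 ∈ ch.C a.2)
    (hb : b ∈ (constructInstance lab ch).manPref a) : b.1 ∈ ch.C b.2 := by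
  obtain ⟨c, v⟩ := a
  rcases (mem_manPref lab ch ha).1 hb with rfl | ⟨e, rfl, rfl, rfl⟩ | rfl
  · exact ha
  · exact ch.colour_mem_src e
  · exact succColour_mem.2 ha

theorem mem_womanPref_colour {a b : Name V} (hb : b.1 ∈ ch.C b.2)
    (ha : a ∈ (constructInstance lab ch).womanPref b) : a.1 ∈ ch.C a.2 := by
  obtain ⟨c, v⟩ := b
  rw [womanPref_eq lab ch hb] at ha
  simp only [List.cons_append, List.mem_cons, List.mem_append, List.mem_map, List.mem_reverse,
    mem_outEdges, List.not_mem_nil, or_false] at ha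
  rcases ha with rfl | ⟨e, ⟨rfl, rfl⟩, rfl⟩ | rfl
  · exact succColour_symm_mem.2 hb
  · exact ch.colour_mem_tgt e
  · exact hb

theorem acceptable_iff {a b : Name V} :
    (constructInstance lab ch).Acceptable a b ↔
      a.1 ∈ ch.C a.2 ∧ b ∈ (constructInstance lab ch).manPref a := by
  rw [SMInstance.Acceptable, men_eq, women_eq, mem_names, mem_names]
  constructor
  · exact fun h => ⟨h.1, h.2.2.1⟩
  · exact fun h => ⟨h.1, mem_manPref_colour lab ch h.1 h.2, h.2,
      (mem_manPref_iff_mem_womanPref lab ch a b).1 h.2⟩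

end Construction

/-! ### Stable matchings of the constructed instance -/

theorem prefers_first {α : Type*} {f z b : α} {l : List α} (hb : b ∈ f :: l ++ [z]) (h : b ≠ f) :
    Prefers (f :: l ++ [z]) f b :=
  prefers_cons_of_mem (by simpa [h] using hb)

theorem prefers_last {α : Type*} {f z b : α} {l : List α} (hb : b ∈ f :: l ++ [z]) (h : b ≠ z) :
    Prefers (f :: l ++ [z]) b z :=
  prefers_concat_of_mem (by simpa [h] using hb)

/-- A function that does not decrease along the orbits of a permutation of finite order is constant
on these orbits. -/
theorem apply_perm_eq_of_le {X V : Type*} [PartialOrder V] {g : Equiv.Perm X} {n : ℕ}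
    (hg : g ^ (n + 1) = 1) {f : X → V} {s : Set X} (hs : ∀ x ∈ s, g x ∈ s)
    (h : ∀ x ∈ s, f x ≤ f (g x)) {x : X} (hx : x ∈ s) : f (g x) = f x := by
  have key : ∀ (n : ℕ), ∀ x ∈ s, (g ^ n) x ∈ s ∧ f x ≤ f ((g ^ n) x) := by
    intro n
    induction n with
    | zero => simp
    | succ n ih =>
      intro x hx
      rw [pow_succ', Equiv.Perm.mul_apply]
      exact ⟨hs _ (ih x hx).1, (ih x hx).2.trans (h _ (ih x hx).1)⟩
  refine le_antisymm ?_ (h x hx)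
  have := (key n (g x) (hs x hx)).2
  rwa [← Equiv.Perm.mul_apply, ← pow_succ, hg, Equiv.Perm.one_apply] at this

theorem isLowerSet_of_hasseEdge {V : Type*} [PartialOrder V] [Finite V] {D : Set V}
    (h : ∀ e : HasseEdge V, e.tgt ∈ D → e.src ∈ D) : IsLowerSet D := by
  classical
  have := Fintype.ofFinite V
  have := @Fintype.toLocallyFiniteOrder V _ _ (Classical.decRel _) (Classical.decRel _)
  intro a b hba ha
  induction le_iff_reflTransGen_covBy.1 hba with
  | refl => exact ha
  | tail _ hcov ih =>
    rename_i c d hbc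
    exact ih (le_iff_reflTransGen_covBy.2 hbc) (h ⟨(c, d), hcov⟩ ha)

section Matching

variable {V : Type*} [PartialOrder V] {φ : HasseEdge V → ℕ+} {p : ℕ}

/-- The matching that belongs to a set `D` of vertices: the man `m_{c,v}` is matched to his last
choice (the cyclically next woman of `v`) if `v ∈ D`, and to his first choice `w_{c,v}` if not. -/
def matchingOf (ch : Choices φ) (D : Set V) : Set (Name V × Name V) :=
  {x | x.1.1 ∈ ch.C x.1.2 ∧ ((x.1.2 ∉ D ∧ x.2 = x.1) ∨
    (x.1.2 ∈ D ∧ x.2 = (succColour ch x.1.2 x.1.1, x.1.2)))}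

variable {ch : Choices φ}

theorem mem_matchingOf {D : Set V} {c : ℕ+} {v : V} {b : Name V} :
    ((c, v), b) ∈ matchingOf ch D ↔
      c ∈ ch.C v ∧ ((v ∉ D ∧ b = (c, v)) ∨ (v ∈ D ∧ b = (succColour ch v c, v))) := Iff.rfl

theorem mem_matchingOf_self {D : Set V} {c : ℕ+} {v : V} (hc : c ∈ ch.C v) (hv : v ∉ D) :
    ((c, v), (c, v)) ∈ matchingOf ch D := ⟨hc, Or.inl ⟨hv, rfl⟩⟩

theorem mem_matchingOf_succ {D : Set V} {c : ℕ+} {v : V} (hc : c ∈ ch.C v) (hv : v ∈ D) :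
    ((c, v), (succColour ch v c, v)) ∈ matchingOf ch D := ⟨hc, Or.inr ⟨hv, rfl⟩⟩

theorem mem_matchingOf_symm {D : Set V} {c : ℕ+} {v : V} (hc : c ∈ ch.C v) (hv : v ∈ D) :
    (((succColour ch v).symm c, v), (c, v)) ∈ matchingOf ch D :=
  ⟨succColour_symm_mem.2 hc, Or.inr ⟨hv, by simp⟩⟩

theorem matchingOf_man_unique {D : Set V} {a b b' : Name V} (h : (a, b) ∈ matchingOf ch D)
    (h' : (a, b') ∈ matchingOf ch D) : b = b' := by
  obtain ⟨c, v⟩ := a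
  rw [mem_matchingOf] at h h'
  rcases h.2 with ⟨_, rfl⟩ | ⟨_, rfl⟩ <;> rcases h'.2 with ⟨_, rfl⟩ | ⟨_, rfl⟩ <;>
    first | rfl | contradiction

theorem matchingOf_woman_unique {D : Set V} {a a' b : Name V} (h : (a, b) ∈ matchingOf ch D)
    (h' : (a', b) ∈ matchingOf ch D) : a = a' := by
  obtain ⟨c, v⟩ := a
  obtain ⟨c', v'⟩ := a'
  rw [mem_matchingOf] at h h'
  rcases h.2 with ⟨_, rfl⟩ | ⟨_, rfl⟩ <;> rcases h'.2 with ⟨_, h⟩ | ⟨_, h⟩ <;>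
    obtain ⟨h1, rfl⟩ := Prod.mk.inj h
  · rw [h1]
  · contradiction
  · contradiction
  · rw [(succColour ch v).injective h1]

theorem exists_mem_colours (ch : Choices φ) (v : V) : ∃ c, c ∈ ch.C v :=
  Finset.card_pos.1 (by have := ch.two_le_card v; omega)

theorem matchingOf_injective (ch : Choices φ) : Function.Injective (matchingOf ch) := by
  intro D E h
  ext v
  obtain ⟨c, hc⟩ := exists_mem_colours ch v
  constructor
  · intro hv
    by_contra hv'
    have h1 := h ▸ mem_matchingOf_succ hc hv
    exact succColour_ne hc (Prod.mk.inj (matchingOf_man_unique h1 (mem_matchingOf_self hc hv'))).1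
  · intro hv
    by_contra hv'
    have h1 := h.symm ▸ mem_matchingOf_succ hc hv
    exact succColour_ne hc (Prod.mk.inj (matchingOf_man_unique h1 (mem_matchingOf_self hc hv'))).1

theorem src_ne_tgt (e : HasseEdge V) : e.src ≠ e.tgt := e.covBy.lt.ne

variable [DecidableEq V]

section PreferenceFacts

variable (lab : Fin p ≃ V) {c : ℕ+} {v : V} {b : Name V}

theorem man_prefers_first (hc : c ∈ ch.C v) (hb : b ∈ (constructInstance lab ch).manPref (c, v))
    (h : b ≠ (c, v)) : Prefers ((constructInstance lab ch).manPref (c, v)) (c, v) b := by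
  rw [manPref_eq lab ch hc] at hb ⊢; exact prefers_first hb h

theorem man_prefers_last (hc : c ∈ ch.C v) (hb : b ∈ (constructInstance lab ch).manPref (c, v))
    (h : b ≠ (succColour ch v c, v)) :
    Prefers ((constructInstance lab ch).manPref (c, v)) b (succColour ch v c, v) := by
  rw [manPref_eq lab ch hc] at hb ⊢; exact prefers_last hb h

theorem man_not_prefers_first (hc : c ∈ ch.C v) :
    ¬ Prefers ((constructInstance lab ch).manPref (c, v)) b (c, v) := by
  have := manPref_nodup lab ch hc
  rw [manPref_eq lab ch hc] at this ⊢; exact not_prefers_head this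

theorem man_not_prefers_last (hc : c ∈ ch.C v) :
    ¬ Prefers ((constructInstance lab ch).manPref (c, v)) (succColour ch v c, v) b := by
  have := manPref_nodup lab ch hc
  rw [manPref_eq lab ch hc] at this ⊢; exact not_prefers_last this

theorem woman_prefers_last (hc : c ∈ ch.C v)
    (hb : b ∈ (constructInstance lab ch).womanPref (c, v)) (h : b ≠ (c, v)) :
    Prefers ((constructInstance lab ch).womanPref (c, v)) b (c, v) := by
  rw [womanPref_eq lab ch hc] at hb ⊢; exact prefers_last hb h

theorem woman_not_prefers_first (hc : c ∈ ch.C v) :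
    ¬ Prefers ((constructInstance lab ch).womanPref (c, v)) b ((succColour ch v).symm c, v) := by
  have := womanPref_nodup lab ch hc
  rw [womanPref_eq lab ch hc] at this ⊢; exact not_prefers_head this

theorem woman_not_prefers_last (hc : c ∈ ch.C v) :
    ¬ Prefers ((constructInstance lab ch).womanPref (c, v)) (c, v) b := by
  have := womanPref_nodup lab ch hc
  rw [womanPref_eq lab ch hc] at this ⊢; exact not_prefers_last this

theorem self_mem_manPref (hc : c ∈ ch.C v) :
    (c, v) ∈ (constructInstance lab ch).manPref (c, v) := (mem_manPref lab ch hc).2 (Or.inl rfl)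

theorem succ_mem_manPref (hc : c ∈ ch.C v) :
    (succColour ch v c, v) ∈ (constructInstance lab ch).manPref (c, v) :=
  (mem_manPref lab ch hc).2 (Or.inr (Or.inr rfl))

theorem src_mem_manPref (e : HasseEdge V) :
    (φ e, e.src) ∈ (constructInstance lab ch).manPref (φ e, e.tgt) :=
  (mem_manPref lab ch (ch.colour_mem_tgt e)).2 (Or.inr (Or.inl ⟨e, rfl, rfl, rfl⟩))

end PreferenceFacts

variable (lab : Fin p ≃ V)

/-- A pair `(m_{c,v}, w_{c,u})` of an edge `(u, v)` blocks the matching of `D` if and only if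
`v ∈ D` and `u ∉ D`; all other acceptable pairs consist of first and last choices and never
block. -/
theorem isStable_matchingOf {D : Set V} (hD : IsLowerSet D) :
    (constructInstance lab ch).IsStable (matchingOf ch D) := by
  refine ⟨⟨?_, fun _ _ _ => matchingOf_man_unique, fun _ _ _ => matchingOf_woman_unique⟩, ?_⟩
  · rintro ⟨c, v⟩ b h
    obtain ⟨hc, ⟨_, rfl⟩ | ⟨_, rfl⟩⟩ := mem_matchingOf.1 h
    · exact (acceptable_iff lab ch).2 ⟨hc, self_mem_manPref lab hc⟩
    · exact (acceptable_iff lab ch).2 ⟨hc, succ_mem_manPref lab hc⟩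
  · rintro ⟨c, v⟩ b ⟨hacc, hm, hw⟩
    obtain ⟨hc, hb⟩ := (acceptable_iff lab ch).1 hacc
    replace hc : c ∈ ch.C v := hc
    have hv : v ∈ D := by
      by_contra hv
      exact man_not_prefers_first lab hc (hm _ (mem_matchingOf_self hc hv))
    have hm' := hm _ (mem_matchingOf_succ hc hv)
    rcases (mem_manPref lab ch hc).1 hb with rfl | ⟨e, rfl, rfl, rfl⟩ | rfl
    · exact woman_not_prefers_last lab hc (hw _ (mem_matchingOf_symm hc hv))
    · exact woman_not_prefers_first lab (ch.colour_mem_src e)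
        (hw _ (mem_matchingOf_symm (ch.colour_mem_src e) (hD e.covBy.le hv)))
    · exact man_not_prefers_last lab hc hm'

/-- In a stable matching `μ` the men not matched to their first choice are matched among the first
choices of these men, and no vertex increases on the way; as the number of these men is finite, the
vertices are in fact unchanged, and each of the men has his last choice. -/
theorem succ_mem_of_isStable {μ : Set (Name V × Name V)}
    (hμ : (constructInstance lab ch).IsStable μ) {c : ℕ+} {v : V} (hc : c ∈ ch.C v)
    (h : ((c, v), (c, v)) ∉ μ) :
    ((c, v), (succColour ch v c, v)) ∈ μ ∧
      ((succColour ch v c, v), (succColour ch v c, v)) ∉ μ := by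
  let S : Set (Name V) := {a | a.1 ∈ ch.C a.2 ∧ (a, a) ∉ μ}
  have hfin : Finite S := ((names lab ch).finite_toSet.subset fun a ha => mem_names.2 ha.1)
  -- The woman `w_a` is matched, as otherwise she would block `μ` together with `m_a`.
  have hex : ∀ a : S, ∃ b : S, (b.1, a.1) ∈ μ := by
    rintro ⟨⟨c, v⟩, hc, ha⟩
    by_contra hno
    push Not at hno
    refine hμ.2 (c, v) (c, v) ⟨(acceptable_iff lab ch).2 ⟨hc, self_mem_manPref lab hc⟩, ?_, ?_⟩
    · intro w hw
      refine man_prefers_first lab hc ((acceptable_iff lab ch).1 (hμ.1.1 _ _ hw)).2 ?_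
      rintro rfl
      exact ha hw
    · intro m hm
      refine absurd hm (hno ⟨m, ((acceptable_iff lab ch).1 (hμ.1.1 _ _ hm)).1, fun h => ha ?_⟩)
      rwa [← hμ.1.2.1 _ _ _ h hm]
  choose g hg using hex
  have hinj : Function.Injective g := fun a a' h =>
    Subtype.ext (hμ.1.2.1 _ _ _ (hg a) (h ▸ hg a'))
  let G : Equiv.Perm S := Equiv.ofBijective g (Finite.injective_iff_bijective.1 hinj)
  obtain ⟨n, hn0, hn⟩ := (isOfFinOrder_of_finite G).exists_pow_eq_one
  obtain ⟨n, rfl⟩ : ∃ k, n = k + 1 := ⟨n - 1, by omega⟩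
  have hle : ∀ a : S, a.1.2 ≤ (G a).1.2 := by
    intro a
    have ha := (acceptable_iff lab ch).1 (hμ.1.1 _ _ (hg a))
    change a.1.2 ≤ (g a).1.2
    rcases (mem_manPref lab ch ha.1).1 ha.2 with h | ⟨e, h1, _, h⟩ | h
    · rw [h]
    · rw [h, ← h1]; exact e.covBy.le
    · rw [h]
  obtain ⟨a, ha⟩ := G.surjective ⟨(c, v), hc, h⟩
  have hga : g a = ⟨(c, v), hc, h⟩ := ha
  have hav := apply_perm_eq_of_le hn (s := Set.univ) (fun _ _ => trivial) (fun a _ => hle a)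
    (Set.mem_univ a)
  have hmem := hg a
  rw [ha] at hav
  rw [hga] at hmem
  have hne : a.1 ≠ (c, v) := by
    intro h'; rw [h'] at hmem; exact h hmem
  have key : a.1 = (succColour ch v c, v) := by
    rcases (mem_manPref lab ch hc).1 ((acceptable_iff lab ch).1 (hμ.1.1 _ _ hmem)).2 with
      h' | ⟨e, h1, _, h'⟩ | h'
    · exact absurd h' hne
    · rw [h'] at hav
      exact absurd (hav.symm.trans h1.symm) (src_ne_tgt e)
    · exact h'
  rw [← key]
  exact ⟨hmem, a.2.2⟩

/-- The set `D` consists of the vertices some, and then all, of whose men do not get their first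
choice; it is a lower set because otherwise the pair of an edge would block. -/
theorem exists_eq_matchingOf {μ : Set (Name V × Name V)}
    (hμ : (constructInstance lab ch).IsStable μ) : ∃ D, IsLowerSet D ∧ μ = matchingOf ch D := by
  have hfinV : Finite V := Finite.of_equiv _ lab
  let D : Set V := {v | ∃ c ∈ ch.C v, ((c, v), (c, v)) ∉ μ}
  have hall : ∀ {c v}, c ∈ ch.C v → v ∈ D → ((c, v), (c, v)) ∉ μ := by
    rintro c v hc ⟨d, hd, h⟩
    exact succColour_induction (P := fun c => ((c, v), (c, v)) ∉ μ)
      (fun c hc h => (succ_mem_of_isStable lab hμ hc h).2) hd h hc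
  have hnot : ∀ {c v}, c ∈ ch.C v → v ∉ D → ((c, v), (c, v)) ∈ μ := by
    intro c v hc hv
    by_contra h
    exact hv ⟨c, hc, h⟩
  have heq : μ = matchingOf ch D := by
    ext ⟨⟨c, v⟩, b⟩
    rw [mem_matchingOf]
    constructor
    · intro h
      have hc : c ∈ ch.C v := ((acceptable_iff lab ch).1 (hμ.1.1 _ _ h)).1
      refine ⟨hc, ?_⟩
      by_cases hv : v ∈ D
      · exact Or.inr ⟨hv, hμ.1.2.1 _ _ _ h (succ_mem_of_isStable lab hμ hc (hall hc hv)).1⟩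
      · exact Or.inl ⟨hv, hμ.1.2.1 _ _ _ h (hnot hc hv)⟩
    · rintro ⟨hc, ⟨hv, rfl⟩ | ⟨hv, rfl⟩⟩
      · exact hnot hc hv
      · exact (succ_mem_of_isStable lab hμ hc (hall hc hv)).1
  refine ⟨D, isLowerSet_of_hasseEdge fun e he => ?_, heq⟩
  by_contra hsrc
  have h1 := ch.colour_mem_tgt e
  have h2 := ch.colour_mem_src e
  have hmem := src_mem_manPref (ch := ch) lab e
  refine hμ.2 (φ e, e.tgt) (φ e, e.src) ⟨(acceptable_iff lab ch).2 ⟨h1, hmem⟩, ?_, ?_⟩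
  · intro w hw
    rw [heq] at hw
    rw [matchingOf_man_unique hw (mem_matchingOf_succ h1 he)]
    exact man_prefers_last lab h1 hmem fun h => src_ne_tgt e (Prod.mk.inj h).2
  · intro m hm
    rw [heq] at hm
    rw [matchingOf_woman_unique hm (mem_matchingOf_self h2 hsrc)]
    exact woman_prefers_last lab h2 ((mem_manPref_iff_mem_womanPref lab ch _ _).1 hmem)
      fun h => src_ne_tgt e (Prod.mk.inj h).2.symm

theorem isStable_iff {μ : Set (Name V × Name V)} :
    (constructInstance lab ch).IsStable μ ↔ ∃ D, IsLowerSet D ∧ μ = matchingOf ch D :=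
  ⟨exists_eq_matchingOf lab, by rintro ⟨D, hD, rfl⟩; exact isStable_matchingOf lab hD⟩

theorem isValid_constructInstance (ch : Choices φ) : (constructInstance lab ch).IsValid where
  man_nodup m hm := by
    rw [men_eq, mem_names] at hm; exact manPref_nodup lab ch hm
  woman_nodup w hw := by
    rw [women_eq, mem_names] at hw; exact womanPref_nodup lab ch hw
  man_subset m hm w hw := by
    rw [men_eq, mem_names] at hm
    rw [women_eq, mem_names]
    exact mem_manPref_colour lab ch hm hw
  woman_subset w hw m hm := by
    rw [women_eq, mem_names] at hw
    rw [men_eq, mem_names]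
    exact mem_womanPref_colour lab ch hw hm
  consistent m _ w _ := mem_manPref_iff_mem_womanPref lab ch m w
  man_matched μ hμ m hm := by
    obtain ⟨D, -, rfl⟩ := exists_eq_matchingOf lab hμ
    rw [men_eq, mem_names] at hm
    by_cases hv : m.2 ∈ D
    · exact ⟨_, mem_matchingOf_succ hm hv⟩
    · exact ⟨_, mem_matchingOf_self hm hv⟩
  woman_matched μ hμ w hw := by
    obtain ⟨D, -, rfl⟩ := exists_eq_matchingOf lab hμ
    rw [women_eq, mem_names] at hw
    by_cases hv : w.2 ∈ D
    · exact ⟨_, mem_matchingOf_symm hw hv⟩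
    · exact ⟨_, mem_matchingOf_self hw hv⟩

theorem isManOptimal_iff {μ : Set (Name V × Name V)} :
    (constructInstance lab ch).IsManOptimal μ ↔ μ = matchingOf ch ∅ := by
  have h0 : (constructInstance lab ch).IsStable (matchingOf ch ∅) :=
    isStable_matchingOf lab isLowerSet_empty
  constructor
  · rintro ⟨hμ, hopt⟩
    obtain ⟨D, -, rfl⟩ := exists_eq_matchingOf lab hμ
    congr 1
    refine Set.eq_empty_of_forall_notMem fun v hv => ?_
    obtain ⟨c, hc⟩ := exists_mem_colours ch v
    rcases hopt _ h0 _ _ _ (mem_matchingOf_succ hc hv) (mem_matchingOf_self hc (by simp)) with h | h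
    · exact succColour_ne hc (Prod.mk.inj h).1
    · exact man_not_prefers_last lab hc h
  · rintro rfl
    refine ⟨h0, ?_⟩
    rintro μ' hμ' ⟨c, v⟩ w w' hw hw'
    obtain ⟨hc, ⟨_, rfl⟩ | ⟨h, _⟩⟩ := mem_matchingOf.1 hw
    · by_cases h : w' = (c, v)
      · exact Or.inl h.symm
      · exact Or.inr (man_prefers_first lab hc
          ((acceptable_iff lab ch).1 (hμ'.1.1 _ _ hw')).2 h)
    · exact absurd h (by simp)

end Matching

/-! ### Rotations of the constructed instance -/

/-- On a circular list of distinct elements, `Follows` is the graph of the cyclic permutation. -/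
theorem follows_iff {α : Type*} [DecidableEq α] {ρ : Cycle α} (hρ : ρ.Nodup) {x y : α} :
    Follows ρ x y ↔ x ∈ ρ ∧ ρ.formPerm hρ x = y := by
  have key : ∀ {y}, Follows ρ x y → ρ.formPerm hρ x = y := by
    rintro y ⟨l, rfl, hy⟩
    change (x :: l).formPerm x = y
    cases l with
    | nil => simpa using hy
    | cons z l =>
      rw [List.formPerm_apply_head _ _ _ (by simpa using hρ)]
      simpa using hy
  constructor
  · refine fun h => ⟨?_, key h⟩
    obtain ⟨l, rfl, -⟩ := h
    simp
  · rintro ⟨hx, rfl⟩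
    obtain ⟨l, hl⟩ : ∃ l : List α, ρ = ((x :: l : List α) : Cycle α) := by
      induction ρ using Quotient.inductionOn with
      | h l =>
      obtain ⟨s, t, rfl⟩ := List.append_of_mem (Cycle.mem_coe_iff.1 hx)
      exact ⟨t ++ s, Cycle.coe_eq_coe.2 List.isRotated_append⟩
    have hex : ∃ y, (l ++ [x]).head? = some y := by
      cases l <;> simp
    obtain ⟨y, hy⟩ := hex
    have hf : Follows ρ x y := ⟨l, hl, hy⟩
    rwa [key hf]

section Rotation

variable {V : Type*} [PartialOrder V] {φ : HasseEdge V → ℕ+} {p : ℕ}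
  {ch : Choices φ}

theorem mem_rho {v : V} {x : Name V × Name V} :
    x ∈ rho ch v ↔ ∃ c ∈ ch.C v, ((c, v), (c, v)) = x := by
  simp [rho, ch.mem_ord]

theorem rho_nodup (ch : Choices φ) (v : V) : (rho ch v).Nodup := by
  rw [rho, Cycle.nodup_coe_iff]
  exact (ch.ord_nodup v).map fun c d h => (Prod.mk.inj (Prod.mk.inj h).1).1

theorem rho_injective (ch : Choices φ) : Function.Injective (rho ch) := by
  intro u v h
  obtain ⟨c, hc⟩ := exists_mem_colours ch u
  have : ((c, u), (c, u)) ∈ rho ch v := h ▸ mem_rho.2 ⟨c, hc, rfl⟩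
  obtain ⟨d, -, hd⟩ := mem_rho.1 this
  exact (Prod.mk.inj (Prod.mk.inj hd).1).2.symm

variable [DecidableEq V]

theorem formPerm_rho {v : V} {c : ℕ+} (hc : c ∈ ch.C v) :
    (rho ch v).formPerm (rho_nodup ch v) ((c, v), (c, v)) =
      ((succColour ch v c, v), (succColour ch v c, v)) := by
  obtain ⟨i, hi, rfl⟩ := List.mem_iff_getElem.1 ((ch.mem_ord v c).2 hc)
  have h := List.formPerm_apply_getElem _ (Cycle.nodup_coe_iff.1 (rho_nodup ch v)) i (by simpa)
  simp only [List.getElem_map, List.length_map] at h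
  rw [succColour, List.formPerm_apply_getElem _ (ch.ord_nodup v), ← h]
  rfl

theorem follows_rho {v : V} {x y : Name V × Name V} :
    Follows (rho ch v) x y ↔ ∃ c ∈ ch.C v, x = ((c, v), (c, v)) ∧
      y = ((succColour ch v c, v), (succColour ch v c, v)) := by
  rw [follows_iff (rho_nodup ch v), mem_rho]
  constructor
  · rintro ⟨⟨c, hc, rfl⟩, rfl⟩
    exact ⟨c, hc, rfl, formPerm_rho hc⟩
  · rintro ⟨c, hc, rfl, rfl⟩
    exact ⟨⟨c, hc, rfl⟩, formPerm_rho hc⟩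

variable (lab : Fin p ≃ V)

theorem exposed_rho {D : Set V} (hD : IsLowerSet D) {v : V} (hv : v ∉ D) (hlt : ∀ u < v, u ∈ D) :
    (constructInstance lab ch).Exposed (matchingOf ch D) (rho ch v) := by
  refine ⟨isStable_matchingOf lab hD, ?_, rho_nodup ch v, ?_, ?_⟩
  · intro h
    obtain ⟨c, hc⟩ := exists_mem_colours ch v
    have : ((c, v), (c, v)) ∈ rho ch v := mem_rho.2 ⟨c, hc, rfl⟩
    rw [h] at this
    exact Cycle.notMem_nil _ this
  · intro x hx
    obtain ⟨c, hc, rfl⟩ := mem_rho.1 hx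
    exact mem_matchingOf_self hc hv
  · intro m w m' w' hf
    obtain ⟨c, hc, h1, h2⟩ := follows_rho.1 hf
    obtain ⟨rfl, rfl⟩ := Prod.mk.inj h1
    obtain ⟨rfl, rfl⟩ := Prod.mk.inj h2
    have hne : (succColour ch v c, v) ≠ (c, v) := fun h => succColour_ne hc (Prod.mk.inj h).1
    refine ⟨man_prefers_first lab hc (succ_mem_manPref lab hc) hne,
      woman_prefers_last lab (succColour_mem.2 hc)
        ((mem_manPref_iff_mem_womanPref lab ch _ _).1 (succ_mem_manPref lab hc)) hne.symm, ?_⟩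
    intro m'' w'' h1 h2 h3 h4
    rcases (mem_manPref lab ch hc).1 h2.mem_left with rfl | ⟨e, rfl, rfl, rfl⟩ | rfl
    · exact man_not_prefers_first lab hc h1
    · have hsrc := ch.colour_mem_src e
      rw [matchingOf_woman_unique h3 (mem_matchingOf_symm hsrc (hlt _ e.covBy.lt))] at h4
      exact woman_not_prefers_first lab hsrc h4
    · exact man_not_prefers_last lab hc h2

/-- A rotation exposed in the matching of `D` moves each of its men to a woman of the same or of a
smaller vertex; going once around the rotation, the vertex has to stay the same. -/
theorem exists_of_exposed {D : Set V} (hD : IsLowerSet D) {ρ : Cycle (Name V × Name V)}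
    (h : (constructInstance lab ch).Exposed (matchingOf ch D) ρ) :
    ∃ v ∉ D, (∀ u < v, u ∈ D) ∧ ρ = rho ch v := by
  have hfinV : Finite V := Finite.of_equiv _ lab
  obtain ⟨-, hnil, hnd, hsub, hfol⟩ := h
  set θ := ρ.formPerm hnd with hθ
  obtain ⟨l, rfl⟩ := Quotient.exists_rep ρ
  change (l : Cycle (Name V × Name V)) ≠ _ at hnil
  change (l : Cycle (Name V × Name V)).Nodup at hnd
  change θ = l.formPerm at hθ
  have hmaps : ∀ x ∈ l, θ x ∈ l := fun x hx => hθ ▸ List.formPerm_apply_mem_of_mem hx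
  -- Each pair of the rotation is a pair of first choices, at a vertex outside `D`.
  have hself : ∀ x ∈ l, ∃ c v, c ∈ ch.C v ∧ v ∉ D ∧ x = ((c, v), (c, v)) := by
    rintro ⟨⟨c, v⟩, w⟩ hx
    obtain ⟨hc, ⟨hv, rfl⟩ | ⟨_, rfl⟩⟩ := mem_matchingOf.1 (hsub _ hx)
    · exact ⟨c, v, hc, hv, rfl⟩
    · have := (hfol _ _ _ _ ((follows_iff hnd).2 ⟨hx, rfl⟩)).1
      exact absurd this (man_not_prefers_last lab hc)
  -- The next pair is at a smaller vertex, or else it is the next pair of `ρ_v`.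
  have hstep : ∀ c v, ((c, v), (c, v)) ∈ l → (θ ((c, v), (c, v))).1.2 ≤ v ∧
      ((θ ((c, v), (c, v))).1.2 = v → θ ((c, v), (c, v)) =
        ((succColour ch v c, v), (succColour ch v c, v))) := by
    intro c v hx
    have hc : c ∈ ch.C v := (mem_matchingOf.1 (hsub _ hx)).1
    obtain ⟨d, u, -, -, hy⟩ := hself _ (hmaps _ hx)
    have := (hfol _ _ _ _ ((follows_iff hnd).2 ⟨hx, hy⟩)).1
    rw [hy]
    rcases (mem_manPref lab ch hc).1 this.mem_right with h | ⟨e, h1, _, h⟩ | h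
    · rw [h] at this
      exact absurd this (man_not_prefers_first lab hc)
    · obtain ⟨rfl, rfl⟩ := Prod.mk.inj h
      exact ⟨h1 ▸ e.covBy.le, fun h => absurd (h.trans h1.symm) (src_ne_tgt e)⟩
    · obtain ⟨rfl, rfl⟩ := Prod.mk.inj h
      exact ⟨le_rfl, fun _ => rfl⟩
  have hlen : l ≠ [] := fun h => hnil (by rw [h]; rfl)
  obtain ⟨n, hn⟩ : ∃ n, l.length = n + 1 :=
    ⟨l.length - 1, by have := List.length_pos_iff.2 hlen; omega⟩
  have hpow : θ ^ (n + 1) = 1 := by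
    rw [← hn, hθ]; exact List.formPerm_pow_length_eq_one_of_nodup l (by simpa using hnd)
  have hnext : ∀ c v, ((c, v), (c, v)) ∈ l → θ ((c, v), (c, v)) =
      ((succColour ch v c, v), (succColour ch v c, v)) := by
    intro c v hx
    refine (hstep c v hx).2 ?_
    refine apply_perm_eq_of_le (V := Vᵒᵈ) (f := fun x : Name V × Name V => x.1.2)
      (s := {x | x ∈ l}) hpow hmaps ?_ hx
    intro x hx
    obtain ⟨c, v, -, -, rfl⟩ := hself x hx
    exact (hstep c v hx).1
  obtain ⟨x, hx⟩ := List.exists_mem_of_ne_nil l hlen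
  obtain ⟨c, v, hc, hv, rfl⟩ := hself x hx
  have hall : ∀ d ∈ ch.C v, ((d, v), (d, v)) ∈ l := fun d hd =>
    succColour_induction (P := fun d => ((d, v), (d, v)) ∈ l)
      (fun d _ h => hnext d v h ▸ hmaps _ h) hc hx hd
  have hvert : ∀ y ∈ l, y.1.2 = v := fun y hy =>
    formPerm_induction (by simpa using hnd) (P := fun y => y.1.2 = v)
      (fun y hy h => by
        obtain ⟨d, u, -, -, rfl⟩ := hself y hy
        rw [← hθ, hnext d u hy]
        exact h) hx rfl hy
  have hmem : ∀ y, y ∈ l ↔ y ∈ rho ch v := by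
    intro y
    rw [mem_rho]
    constructor
    · intro hy
      obtain ⟨d, u, hd, -, rfl⟩ := hself y hy
      obtain rfl : u = v := hvert _ hy
      exact ⟨d, hd, rfl⟩
    · rintro ⟨d, hd, rfl⟩; exact hall d hd
  have hperm : (l : Cycle (Name V × Name V)).formPerm hnd =
      (rho ch v).formPerm (rho_nodup ch v) := by
    ext1 y
    by_cases hy : y ∈ l
    · obtain ⟨d, hd, rfl⟩ := mem_rho.1 ((hmem y).1 hy)
      rw [formPerm_rho hd, ← hnext d v hy]
      rfl
    · rw [Cycle.formPerm_eq_self_of_notMem _ _ _ hy,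
        Cycle.formPerm_eq_self_of_notMem _ _ _ fun h => hy ((hmem y).2 h)]
  refine ⟨v, hv, fun u hu => ?_, ?_⟩
  · obtain ⟨w, huw, hwv⟩ := exists_le_covBy_of_lt hu
    refine hD huw ?_
    let e : HasseEdge V := ⟨(w, v), hwv⟩
    have hφ : φ e ∈ ch.C v := ch.colour_mem_tgt e
    have hsrc : φ e ∈ ch.C w := ch.colour_mem_src e
    have hmemp : (φ e, w) ∈ (constructInstance lab ch).manPref (φ e, v) :=
      src_mem_manPref lab e
    by_contra hw
    have hle := hall _ hφ
    refine (hfol _ _ _ _ ((follows_iff hnd).2 ⟨hle, hnext _ _ hle⟩)).2.2 (φ e, w) (φ e, w)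
      (man_prefers_first lab hφ hmemp fun h => hwv.lt.ne (Prod.mk.inj h).2)
      (man_prefers_last lab hφ hmemp fun h => hwv.lt.ne (Prod.mk.inj h).2)
      (mem_matchingOf_self hsrc hw)
      (woman_prefers_last lab hsrc ((mem_manPref_iff_mem_womanPref lab ch _ _).1 hmemp)
        fun h => hwv.lt.ne (Prod.mk.inj h).2.symm)
  · rcases Cycle.formPerm_eq_formPerm_iff.1 hperm with h | ⟨-, h⟩
    · exact h
    · rw [rho, Cycle.Subsingleton, Cycle.length_coe, List.length_map, ch.length_ord] at h
      have := ch.two_le_card v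
      omega

theorem exposed_iff {μ : Set (Name V × Name V)} {ρ : Cycle (Name V × Name V)} :
    (constructInstance lab ch).Exposed μ ρ ↔ ∃ D, IsLowerSet D ∧ μ = matchingOf ch D ∧
      ∃ v ∉ D, (∀ u < v, u ∈ D) ∧ ρ = rho ch v := by
  constructor
  · intro h
    obtain ⟨D, hD, rfl⟩ := exists_eq_matchingOf lab h.1
    exact ⟨D, hD, rfl, exists_of_exposed lab hD h⟩
  · rintro ⟨D, hD, rfl, v, hv, hlt, rfl⟩
    exact exposed_rho lab hD hv hlt

theorem eliminate_rho {D : Set V} {v : V} (hv : v ∉ D) :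
    SMInstance.eliminate (matchingOf ch D) (rho ch v) = matchingOf ch (insert v D) := by
  ext ⟨⟨c, u⟩, b⟩
  simp only [SMInstance.eliminate, Set.mem_union, Set.mem_sdiff, Set.mem_ofPred_eq, follows_rho,
    mem_rho, mem_matchingOf, Set.mem_insert_iff]
  constructor
  · rintro (⟨⟨hc, h⟩, hno⟩ | ⟨x, y, ⟨d, hd, rfl, rfl⟩, h⟩)
    · refine ⟨hc, ?_⟩
      rcases h with ⟨hu, rfl⟩ | ⟨hu, rfl⟩
      · refine Or.inl ⟨?_, rfl⟩
        rintro (rfl | h)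
        · exact hno ⟨c, hc, rfl⟩
        · exact hu h
      · exact Or.inr ⟨Or.inr hu, rfl⟩
    · obtain ⟨h1, rfl⟩ := Prod.mk.inj h
      obtain ⟨rfl, rfl⟩ := Prod.mk.inj h1
      exact ⟨hd, Or.inr ⟨Or.inl rfl, rfl⟩⟩
  · rintro ⟨hc, ⟨hu, rfl⟩ | ⟨rfl | hu, rfl⟩⟩
    · refine Or.inl ⟨⟨hc, Or.inl ⟨fun h => hu (Or.inr h), rfl⟩⟩, ?_⟩
      rintro ⟨d, hd, h⟩
      exact hu (Or.inl (Prod.mk.inj (Prod.mk.inj h).1).2.symm)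
    · exact Or.inr ⟨_, _, ⟨c, hc, rfl, rfl⟩, rfl⟩
    · refine Or.inl ⟨⟨hc, Or.inr ⟨hu, rfl⟩⟩, ?_⟩
      rintro ⟨d, hd, h⟩
      exact hv ((Prod.mk.inj (Prod.mk.inj h).1).2 ▸ hu)

theorem eq_image_of_reaches {μ : Set (Name V × Name V)} {R : Set (Cycle (Name V × Name V))}
    (h : (constructInstance lab ch).Reaches μ R) :
    ∃ D, IsLowerSet D ∧ μ = matchingOf ch D ∧ R = rho ch '' D := by
  induction h with
  | start μ h => exact ⟨∅, isLowerSet_empty, (isManOptimal_iff lab).1 h, by simp⟩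
  | step μ R ρ _ hρ ih =>
    obtain ⟨D, hD, rfl, rfl⟩ := ih
    obtain ⟨v, hv, hlt, rfl⟩ := exists_of_exposed lab hD hρ
    refine ⟨insert v D, ?_, eliminate_rho hv, (Set.image_insert_eq ..).symm⟩
    rintro a b hba (rfl | ha)
    · rcases hba.eq_or_lt with rfl | hb
      · exact Or.inl rfl
      · exact Or.inr (hlt b hb)
    · exact Or.inr (hD hba ha)

/-- Removing a maximal vertex from `D` gives the matching from which `D` is reached in one step. -/
theorem reaches_matchingOf {D : Set V} (hD : IsLowerSet D) :
    (constructInstance lab ch).Reaches (matchingOf ch D) (rho ch '' D) := by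
  have hfinV : Finite V := Finite.of_equiv _ lab
  obtain ⟨n, hn⟩ : ∃ n, D.ncard = n := ⟨_, rfl⟩
  induction n generalizing D with
  | zero =>
    obtain rfl := (Set.ncard_eq_zero D.toFinite).1 hn
    rw [Set.image_empty]
    exact .start _ ((isManOptimal_iff lab).2 rfl)
  | succ n ih =>
    have hne : D.Nonempty := Set.nonempty_of_ncard_ne_zero (by omega)
    obtain ⟨v, hv⟩ := D.toFinite.exists_maximal hne
    have hlow : IsLowerSet (D \ {v}) := by
      rintro a b hba ⟨ha, hav⟩
      refine ⟨hD hba ha, ?_⟩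
      rintro rfl
      exact hav (le_antisymm (hv.2 ha hba) hba)
    have hins : insert v (D \ {v}) = D := by
      rw [Set.insert_sdiff_singleton, Set.insert_eq_of_mem hv.1]
    have hcard : (D \ {v}).ncard = n := by
      rw [Set.ncard_sdiff_singleton_of_mem hv.1, hn, Nat.add_sub_cancel]
    have hnot : v ∉ D \ {v} := fun h => h.2 rfl
    have := SMInstance.Reaches.step _ _ _ (ih hlow hcard) (exposed_rho lab hlow hnot
      fun u hu => ⟨hD hu.le hv.1, hu.ne⟩)
    rwa [eliminate_rho hnot, ← Set.image_insert_eq, hins] at this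

theorem exists_relIso (ch : Choices φ) :
    ∃ f : ((· < ·) : V → V → Prop) ≃r (constructInstance lab ch).Precedes,
      ∀ v, (f v : Cycle (Name V × Name V)) = rho ch v := by
  have hexp : ∀ v, (constructInstance lab ch).Exposed (matchingOf ch (Set.Iio v)) (rho ch v) :=
    fun v => exposed_rho lab (isLowerSet_Iio v) (by simp) fun u hu => hu
  let f : V → (constructInstance lab ch).rotations := fun v => ⟨rho ch v, _, hexp v⟩
  have hf : Function.Bijective f := by
    constructor
    · exact fun u v h => rho_injective ch (congrArg Subtype.val h)
    · rintro ⟨ρ, μ, hμ⟩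
      obtain ⟨D, -, -, v, -, -, rfl⟩ := (exposed_iff lab).1 hμ
      exact ⟨v, rfl⟩
  refine ⟨⟨Equiv.ofBijective f hf, ?_⟩, fun v => rfl⟩
  intro u v
  constructor
  · intro h
    obtain ⟨R, hR, hu⟩ := h _ (hexp v)
    obtain ⟨D, -, hD, rfl⟩ := eq_image_of_reaches lab hR
    rw [← matchingOf_injective ch hD] at hu
    obtain ⟨w, hw, hwu⟩ := hu
    rwa [rho_injective ch hwu] at hw
  · intro huv μ hμ
    obtain ⟨D, hD, rfl, w, -, hlt, hw⟩ := (exposed_iff lab).1 hμ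
    obtain rfl := rho_injective ch hw
    exact ⟨_, reaches_matchingOf lab hD, u, hlt u huv, rfl⟩

end Rotation

/-! ### The size of the instance -/

theorem card_hasseEdge_eq_length {V : Type*} [PartialOrder V] {l : List (HasseEdge V)}
    (hl : l.Nodup) (h : ∀ e, e ∈ l) : Nat.card (HasseEdge V) = l.length := by
  classical
  rw [← Nat.card_congr (hl.getEquivOfForallMemList l h), Nat.card_fin]

/-- Each name is `(φ e, v)` for an edge `e` with an endpoint `v`, or `(1, v)`, or `(2, v)`. -/
theorem card_names_le {V : Type*} [PartialOrder V] [DecidableEq V] {φ : HasseEdge V → ℕ+} {p : ℕ}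
    (lab : Fin p ≃ V) (ch : Choices φ) :
    (names lab ch).card ≤ 2 * (p + Nat.card (HasseEdge V)) := by
  have hsub : names lab ch ⊆ (ch.edges.map (fun e => (φ e, e.src)) ++
      ch.edges.map (fun e => (φ e, e.tgt)) ++ (List.finRange p).map (fun i => (1, lab i)) ++
      (List.finRange p).map (fun i => (2, lab i))).toFinset := by
    rintro ⟨c, v⟩ h
    rw [mem_names] at h
    have hcol : c ∈ incidentColours φ v ∪ {1, 2} := by
      rcases le_or_gt 2 (incidentColours φ v).ncard with h2 | h2
      · exact Or.inl ((ch.C_eq v h2).le h)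
      · exact (ch.C_pad v h2).2.1 h
    simp only [List.mem_toFinset, List.mem_append, List.mem_map, ch.mem_edges, true_and,
      List.mem_finRange, Prod.mk.injEq]
    rcases hcol with ⟨e, rfl | rfl, rfl⟩ | rfl | rfl
    · exact Or.inl (Or.inl (Or.inl ⟨e, rfl, rfl⟩))
    · exact Or.inl (Or.inl (Or.inr ⟨e, rfl, rfl⟩))
    · exact Or.inl (Or.inr ⟨lab.symm v, rfl, by simp⟩)
    · exact Or.inr ⟨lab.symm v, rfl, by simp⟩
  refine (Finset.card_le_card hsub).trans ((List.toFinset_card_le _).trans ?_)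
  rw [card_hasseEdge_eq_length ch.edges_nodup ch.mem_edges]
  simp
  omega

/-! ### Reasoning about programs -/

/-- The programs of a list, run one after the other. -/
def Program.block : List Program → Program
  | [] => .skip
  | P :: Ps => .seq P (block Ps)

/-- Started in `s`, the program `P` halts, after some number `t` of steps and in some state `s'`
such that `Q t s'`. -/
def Wp (P : Program) (Q : ℕ → State → Prop) (s : State) : Prop := ∃ t s', Runs P s t s' ∧ Q t s'

section Wp

variable {P P' : Program} {Ps : List Program} {Q Q' : ℕ → State → Prop} {s : State} {e i : Expr}
  {x a : ℕ}

theorem Wp.mono (h : Wp P Q s) (hQ : ∀ t s', Q t s' → Q' t s') : Wp P Q' s := by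
  obtain ⟨t, s', hr, hq⟩ := h
  exact ⟨t, s', hr, hQ _ _ hq⟩

theorem wp_skip : Wp .skip Q s ↔ Q 1 s := by
  constructor
  · rintro ⟨_, _, ⟨⟩, h⟩; exact h
  · exact fun h => ⟨_, _, .skip s, h⟩

theorem wp_assign : Wp (.assign x e) Q s ↔
    Q (e.cost + 1) { s with reg := Function.update s.reg x (e.eval s) } := by
  constructor
  · rintro ⟨_, _, ⟨⟩, h⟩; exact h
  · exact fun h => ⟨_, _, .assign x e s, h⟩

theorem wp_store : Wp (.store a i e) Q s ↔
    Q (i.cost + e.cost + 1)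
      { s with arr := Function.update s.arr a
                (Function.update (s.arr a) (i.eval s) (e.eval s)) } := by
  constructor
  · rintro ⟨_, _, ⟨⟩, h⟩; exact h
  · exact fun h => ⟨_, _, .store a i e s, h⟩

theorem wp_emit : Wp (.emit e) Q s ↔ Q (e.cost + 1) { s with out := s.out ++ [e.eval s] } := by
  constructor
  · rintro ⟨_, _, ⟨⟩, h⟩; exact h
  · exact fun h => ⟨_, _, .emit e s, h⟩

theorem wp_seq : Wp (.seq P P') Q s ↔
    Wp P (fun t s' => Wp P' (fun t' s'' => Q (t + t') s'') s') s := by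
  constructor
  · rintro ⟨_, _, hr, h⟩
    cases hr with
    | seq _ _ _ _ _ _ _ h1 h2 => exact ⟨_, _, h1, _, _, h2, h⟩
  · rintro ⟨_, _, h1, _, _, h2, h⟩
    exact ⟨_, _, .seq _ _ _ _ _ _ _ h1 h2, h⟩

theorem wp_block_nil : Wp (.block []) Q s ↔ Q 1 s := wp_skip

theorem wp_block_cons : Wp (.block (P :: Ps)) Q s ↔
    Wp P (fun t s' => Wp (.block Ps) (fun t' s'' => Q (t + t') s'') s') s := wp_seq

theorem wp_cond_true (he : e.eval s ≠ 0) (h : Wp P (fun t => Q (e.cost + 1 + t)) s) :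
    Wp (.cond e P P') Q s := by
  obtain ⟨_, _, h1, h⟩ := h
  exact ⟨_, _, .condTrue _ _ _ _ _ _ he h1, h⟩

theorem wp_cond_false (he : e.eval s = 0) (h : Wp P' (fun t => Q (e.cost + 1 + t)) s) :
    Wp (.cond e P P') Q s := by
  obtain ⟨_, _, h1, h⟩ := h
  exact ⟨_, _, .condFalse _ _ _ _ _ _ he h1, h⟩

theorem wp_loop_true (he : e.eval s ≠ 0)
    (h : Wp P (fun t s' => Wp (.loop e P) (fun t' => Q (e.cost + 1 + t + t')) s') s) :
    Wp (.loop e P) Q s := by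
  obtain ⟨_, _, h1, _, _, h2, h⟩ := h
  exact ⟨_, _, .loopTrue _ _ _ _ _ _ _ he h1 h2, h⟩

theorem wp_loop_false (he : e.eval s = 0) (h : Q (e.cost + 1) s) : Wp (.loop e P) Q s :=
  ⟨_, _, .loopFalse _ _ _ he, h⟩

end Wp

namespace Program

/-- The arrays that the program writes to. -/
def arrs : Program → List ℕ
  | skip => []
  | assign _ _ => []
  | store a _ _ => [a]
  | emit _ => []
  | seq P Q => P.arrs ++ Q.arrs
  | cond _ P Q => P.arrs ++ Q.arrs
  | loop _ P => P.arrs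

/-- The registers that the program writes to. -/
def regs : Program → List ℕ
  | skip => []
  | assign x _ => [x]
  | store _ _ _ => []
  | emit _ => []
  | seq P Q => P.regs ++ Q.regs
  | cond _ P Q => P.regs ++ Q.regs
  | loop _ P => P.regs

/-- Whether the program contains an output statement. -/
def emits : Program → Bool
  | skip => false
  | assign _ _ => false
  | store _ _ _ => false
  | emit _ => true
  | seq P Q => P.emits || Q.emits
  | cond _ P Q => P.emits || Q.emits
  | loop _ P => P.emits

end Program

/-- The states `s` and `s'` agree on everything that `P` does not write to. -/
structure Frame (P : Program) (s s' : State) : Prop where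
  arr : ∀ a ∉ P.arrs, s'.arr a = s.arr a
  reg : ∀ x ∉ P.regs, s'.reg x = s.reg x
  out : P.emits = false → s'.out = s.out

theorem Frame.refl (P : Program) (s : State) : Frame P s s :=
  ⟨fun _ _ => rfl, fun _ _ => rfl, fun _ => rfl⟩

theorem Frame.trans {P : Program} {s s' s'' : State} (h : Frame P s s') (h' : Frame P s' s'') :
    Frame P s s'' :=
  ⟨fun a ha => (h'.arr a ha).trans (h.arr a ha), fun x hx => (h'.reg x hx).trans (h.reg x hx),
    fun he => (h'.out he).trans (h.out he)⟩

theorem Frame.mono {P P' : Program} {s s' : State} (h : Frame P s s') (ha : P.arrs ⊆ P'.arrs)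
    (hr : P.regs ⊆ P'.regs) (he : P'.emits = false → P.emits = false) : Frame P' s s' :=
  ⟨fun a h' => h.arr a fun h'' => h' (ha h''), fun x h' => h.reg x fun h'' => h' (hr h''),
    fun h' => h.out (he h')⟩

theorem Runs.frame {P : Program} {s s' : State} {t : ℕ} (h : Runs P s t s') : Frame P s s' := by
  induction h with
  | skip s => exact .refl _ _
  | assign x e s =>
    refine ⟨fun _ _ => rfl, fun y hy => ?_, fun _ => rfl⟩
    exact Function.update_of_ne (by simpa [Program.regs] using hy) _ _
  | store a i e s =>
    refine ⟨fun b hb => ?_, fun _ _ => rfl, fun _ => rfl⟩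
    exact Function.update_of_ne (by simpa [Program.arrs] using hb) _ _
  | emit e s => exact ⟨fun _ _ => rfl, fun _ _ => rfl, fun h => by simp [Program.emits] at h⟩
  | seq P Q s s' s'' t t' _ _ h1 h2 =>
    refine (h1.mono ?_ ?_ ?_).trans (h2.mono ?_ ?_ ?_) <;>
      simp +contextual [Program.arrs, Program.regs, Program.emits]
  | condTrue e P Q s s' t he _ h1 =>
    refine h1.mono ?_ ?_ ?_ <;> simp +contextual [Program.arrs, Program.regs, Program.emits]
  | condFalse e P Q s s' t he _ h1 =>
    refine h1.mono ?_ ?_ ?_ <;> simp +contextual [Program.arrs, Program.regs, Program.emits]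
  | loopTrue e P s s' s'' t t' he _ _ h1 h2 => exact Frame.trans ⟨h1.arr, h1.reg, h1.out⟩ h2
  | loopFalse e P s he => exact .refl _ _

theorem Wp.frame {P : Program} {Q : ℕ → State → Prop} {s : State} (h : Wp P Q s) :
    Wp P (fun t s' => Q t s' ∧ Frame P s s') s := by
  obtain ⟨t, s', hr, hq⟩ := h
  exact ⟨t, s', hr, hq, hr.frame⟩

/-- The rule for a loop with `n` rounds.  The invariant `Inv k T s` speaks of the number `k` of the
rounds completed and of the number `T` of the steps used so far. -/
theorem wp_loop {e : Expr} {P : Program} {s₀ : State} (n : ℕ) (Inv : ℕ → ℕ → State → Prop)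
    (h0 : Inv 0 0 s₀)
    (hstep : ∀ k T s, k < n → Frame P s₀ s → Inv k T s → e.eval s ≠ 0 ∧
      Wp P (fun t s' => Inv (k + 1) (T + (e.cost + 1 + t)) s') s)
    (hend : ∀ T s, Frame P s₀ s → Inv n T s → e.eval s = 0) :
    Wp (.loop e P) (fun t s' => ∃ T, Inv n T s' ∧ t = T + (e.cost + 1)) s₀ := by
  suffices ∀ m k T s, k + m = n → Frame P s₀ s → Inv k T s →
      Wp (.loop e P) (fun t s' => ∃ T', Inv n T' s' ∧ T + t = T' + (e.cost + 1)) s by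
    refine (this n 0 0 s₀ (by simp) (.refl _ _) h0).mono ?_
    rintro t s' ⟨T, h, h'⟩
    exact ⟨T, h, by omega⟩
  intro m
  induction m with
  | zero =>
    rintro k T s rfl hf h
    exact wp_loop_false (hend T s hf h) ⟨T, h, rfl⟩
  | succ m ih =>
    intro k T s hk hf h
    obtain ⟨he, hw⟩ := hstep k T s (by omega) hf h
    refine wp_loop_true he (hw.frame.mono ?_)
    rintro t s' ⟨h', hf'⟩
    refine (ih (k + 1) _ s' (by omega) (hf.trans hf') h').mono ?_
    rintro t' s'' ⟨T', h1, h2⟩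
    exact ⟨T', h1, by omega⟩

/-- Runs `P` for the values `0, 1, …` of the register `x` that are less than the value of `n`. -/
def forLoop (x : ℕ) (n : Expr) (P : Program) : Program :=
  .block [.assign x (.const 0),
    .loop (.lt (.reg x) n) (.block [P, .assign x (.add (.reg x) (.const 1))])]

/-- The rule for a `for` loop: the body keeps its control register, and the bound does not
change. -/
theorem wp_forLoop {x : ℕ} {e : Expr} {P : Program} {s₀ : State} (n : ℕ)
    (Inv : ℕ → ℕ → State → Prop)
    (hinv : ∀ k T s y, Inv k T s → Inv k T { s with reg := Function.update s.reg x y })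
    (hx : x ∉ P.regs)
    (h0 : Inv 0 0 s₀)
    (hstep : ∀ k T s, k < n → Frame (forLoop x e P) s₀ s → s.reg x = k → Inv k T s →
      Wp P (fun t s' => Inv (k + 1) (T + (e.cost + 8 + t)) s') s)
    (he : ∀ s, Frame (forLoop x e P) s₀ s → e.eval s = n) :
    Wp (forLoop x e P) (fun t s' => ∃ T, Inv n T s' ∧ t = T + (e.cost + 6)) s₀ := by
  rw [forLoop, wp_block_cons, wp_assign, wp_block_cons]
  have hF0 : Frame (forLoop x e P) s₀ { s₀ with reg := Function.update s₀.reg x 0 } := by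
    refine ⟨fun _ _ => rfl, fun y hy => ?_, fun _ => rfl⟩
    refine Function.update_of_ne ?_ _ _
    rintro rfl
    simp [forLoop, Program.block, Program.regs] at hy
  have hF : ∀ {s s'}, Frame (.block [P, .assign x (.add (.reg x) (.const 1))]) s s' →
      Frame (forLoop x e P) s s' := by
    intro s s' h
    refine h.mono ?_ ?_ ?_ <;>
      simp +contextual [forLoop, Program.block, Program.regs, Program.arrs, Program.emits]
  refine (wp_loop n (fun k T s => s.reg x = k ∧ Inv k T s) ?_ ?_ ?_).mono ?_
  · exact ⟨by simp [Expr.eval], hinv _ _ _ _ h0⟩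
  · rintro k T s hk hf ⟨hxk, h⟩
    have hF' := hF0.trans (hF hf)
    refine ⟨by simp [Expr.eval, hxk, he s hF', hk], ?_⟩
    rw [wp_block_cons]
    refine (hstep k T s hk hF' hxk h).frame.mono ?_
    rintro t s' ⟨h', hf'⟩
    rw [wp_block_cons, wp_assign, wp_block_nil]
    have := hf'.reg x hx
    refine ⟨by simp [Expr.eval, this, hxk], ?_⟩
    have h2 := hinv _ _ _ ((Expr.add (.reg x) (.const 1)).eval s') h'
    convert h2 using 1
    simp only [Expr.cost]; omega
  · rintro T s hf ⟨hxk, h⟩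
    have hF' := hF0.trans (hF hf)
    simp [Expr.eval, hxk, he s hF']
  · rintro t s' ⟨T, ⟨-, h⟩, rfl⟩
    rw [wp_block_nil]
    exact ⟨T, h, by simp only [Expr.cost]; omega⟩

/-! ### The program: input, keys and colours -/

section Preparation

variable {V : Type*} [PartialOrder V] {p : ℕ}

/-- The input array. -/
def inputArr (lab : Fin p ≃ V) (φ : HasseEdge V → ℕ+) (edges : List (HasseEdge V)) : ℕ → ℕ :=
  fun i => (encodeInput lab φ edges).getD i 0

theorem getD_flatMap_three {α : Type*} (f g h : α → ℕ) (l : List α) (i : ℕ) (hi : i < l.length) :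
    (l.flatMap fun x => [f x, g x, h x]).getD (i + i + i) 0 = f l[i] ∧
    (l.flatMap fun x => [f x, g x, h x]).getD (i + i + i + 1) 0 = g l[i] ∧
    (l.flatMap fun x => [f x, g x, h x]).getD (i + i + i + 2) 0 = h l[i] := by
  induction l generalizing i with
  | nil => simp at hi
  | cons x l ih =>
    cases i with
    | zero => simp
    | succ i =>
      have := ih i (by simpa using hi)
      rw [show i + 1 + (i + 1) + (i + 1) = i + i + i + 3 by omega]
      simpa using this

variable (lab : Fin p ≃ V) (φ : HasseEdge V → ℕ+) (edges : List (HasseEdge V))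

theorem inputArr_zero : inputArr lab φ edges 0 = p := rfl

theorem inputArr_one : inputArr lab φ edges 1 = edges.length := rfl

variable {edges} {i : ℕ}

theorem inputArr_src (hi : i < edges.length) :
    inputArr lab φ edges (i + i + (i + 2)) = lab.symm edges[i].src := by
  rw [← (getD_flatMap_three (fun e => (lab.symm e.src : ℕ)) (fun e => (lab.symm e.tgt : ℕ))
    (fun e => (φ e : ℕ)) edges i hi).1]
  rfl

theorem inputArr_tgt (hi : i < edges.length) :
    inputArr lab φ edges (i + i + (i + 3)) = lab.symm edges[i].tgt := by
  rw [← (getD_flatMap_three (fun e => (lab.symm e.src : ℕ)) (fun e => (lab.symm e.tgt : ℕ))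
    (fun e => (φ e : ℕ)) edges i hi).2.1]
  rfl

theorem inputArr_colour (hi : i < edges.length) :
    inputArr lab φ edges (i + i + (i + 4)) = φ edges[i] := by
  rw [← (getD_flatMap_three (fun e => (lab.symm e.src : ℕ)) (fun e => (lab.symm e.tgt : ℕ))
    (fun e => (φ e : ℕ)) edges i hi).2.2]
  rfl

end Preparation

/-- The field number `k` of the edge in register `10`: the lower endpoint for `k = 2`, the upper
endpoint for `k = 3` and the colour for `k = 4`. -/
def edgeField (k : ℕ) : Expr :=
  .arr 0 (.add (.add (.reg 10) (.reg 10)) (.add (.reg 10) (.const k)))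

/-- Sets register `4` to a number `B` that exceeds all colours, including the colours `1` and `2`
used for padding. -/
def boundProg : Program :=
  .block [.assign 4 (.const 3), forLoop 0 (.arr 0 (.const 1))
    (.block [.assign 10 (.reg 0), .assign 4 (.add (.reg 4) (edgeField 4))])]

/-- Sets the cells `v < p` of array `1` to `v * B`.  The pair of a vertex `v` and a number `c < B`
is then addressed by the key `v * B + c`. -/
def baseProg : Program :=
  .block [.assign 9 (.const 0), forLoop 0 (.arr 0 (.const 0))
    (.block [.store 1 (.reg 0) (.reg 9), .assign 9 (.add (.reg 9) (.reg 4))])]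

section Preparation

variable {V : Type*} [PartialOrder V] {p : ℕ} {lab : Fin p ≃ V} {φ : HasseEdge V → ℕ+}
  {edges : List (HasseEdge V)} {s : State}

theorem wp_boundProg (hs : s.arr 0 = inputArr lab φ edges) :
    Wp boundProg (fun t s' => t ≤ 40 * (edges.length + 1) ∧ 3 ≤ s'.reg 4 ∧
      ∀ e ∈ edges, (φ e : ℕ) < s'.reg 4) s := by
  rw [boundProg, wp_block_cons, wp_assign, wp_block_cons]
  refine (wp_forLoop edges.length (fun k T s => T ≤ 40 * k ∧ 3 ≤ s.reg 4 ∧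
    ∀ e ∈ edges.take k, (φ e : ℕ) < s.reg 4) ?_ (by decide) ?_ ?_ ?_).mono ?_
  · intro k T s y h; simpa using h
  · simp [Expr.eval]
  · rintro k T s hk hf hx ⟨hT, h3, h⟩
    have harr : s.arr 0 = inputArr lab φ edges := (hf.arr 0 (by decide)).trans hs
    simp only [wp_block_cons, wp_assign, wp_block_nil, edgeField, Expr.eval, Expr.cost, harr, hx,
      Function.update_self, ne_eq, Nat.reduceEqDiff,
        not_false_eq_true, Function.update_of_ne, inputArr_colour lab φ hk]
    refine ⟨by omega, by omega, ?_⟩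
    intro e he
    rw [List.take_succ_eq_append_getElem hk, List.mem_append, List.mem_singleton] at he
    rcases he with he | rfl
    · have := h e he; omega
    · omega
  · intro s hf
    have harr : s.arr 0 = inputArr lab φ edges := (hf.arr 0 (by decide)).trans hs
    simp [Expr.eval, harr, inputArr_one]
  · rintro t s' ⟨T, ⟨hT, h3, h⟩, rfl⟩
    rw [wp_block_nil]
    refine ⟨by simp only [Expr.cost]; omega, h3, ?_⟩
    rwa [List.take_length] at h

theorem wp_baseProg (hs : s.arr 0 = inputArr lab φ edges) :
    Wp baseProg (fun t s' => t ≤ 40 * (p + 1) ∧ ∀ i < p, s'.arr 1 i = i * s.reg 4) s := by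
  rw [baseProg, wp_block_cons, wp_assign, wp_block_cons]
  refine (wp_forLoop p (fun k T s' => T ≤ 40 * k ∧ s'.reg 9 = k * s.reg 4 ∧
    ∀ i < k, s'.arr 1 i = i * s.reg 4) ?_ (by decide) ?_ ?_ ?_).mono ?_
  · intro k T s y h; simpa using h
  · simp [Expr.eval]
  · rintro k T s' hk hf hx ⟨hT, h9, h⟩
    have h4 : s'.reg 4 = s.reg 4 := (hf.reg 4 (by decide)).trans (by simp)
    simp only [wp_block_cons, wp_assign, wp_store, wp_block_nil, Expr.eval, Expr.cost, hx, h9, h4,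
      Function.update_self]
    refine ⟨by omega, by ring, ?_⟩
    intro i hi
    rcases (Nat.lt_succ_iff_lt_or_eq.1 hi) with hi | rfl
    · rw [Function.update_of_ne hi.ne, h i hi]
    · rw [Function.update_self]
  · intro s' hf
    have harr : s'.arr 0 = inputArr lab φ edges := (hf.arr 0 (by decide)).trans hs
    simp [Expr.eval, harr, inputArr_zero]
  · rintro t s' ⟨T, ⟨hT, h9, h⟩, rfl⟩
    rw [wp_block_nil]
    exact ⟨by simp only [Expr.cost]; omega, h⟩

end Preparation

/-- Keys of pairs are unambiguous. -/
theorem key_inj {B v v' c c' : ℕ} (hc : c < B) (hc' : c' < B) :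
    v * B + c = v' * B + c' ↔ v = v' ∧ c = c' := by
  constructor
  · intro h
    have h1 := congrArg (· / B) h
    have h2 := congrArg (· % B) h
    have hB : 0 < B := by omega
    simp only [Nat.mul_comm _ B, Nat.mul_add_div hB, Nat.mul_add_mod, Nat.div_eq_of_lt hc,
      Nat.div_eq_of_lt hc', Nat.mod_eq_of_lt hc, Nat.mod_eq_of_lt hc'] at h1 h2
    exact ⟨by simpa using h1, h2⟩
  · rintro ⟨rfl, rfl⟩; rfl

/-- The key of the vertex in register `2` and the colour in register `3`. -/
def keyExpr : Expr := .add (.arr 1 (.reg 2)) (.reg 3)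

/-- Adds the colour in register `3` to the colours of the vertex in register `2` unless it is
already there.  Array `2` marks the keys of the pairs present, array `3` holds the colours of each
vertex one after the other, array `4` their number, and register `7` the number of all pairs. -/
def addColour : Program :=
  .cond (.eq (.arr 2 keyExpr) (.const 0))
    (.block [.store 3 (.add (.arr 1 (.reg 2)) (.arr 4 (.reg 2))) (.reg 3),
      .store 4 (.reg 2) (.add (.arr 4 (.reg 2)) (.const 1)), .store 2 keyExpr (.const 1),
      .assign 7 (.add (.reg 7) (.const 1))])
    .skip

/-- Collects the colours of the edges at each vertex. -/
def colourProg : Program :=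
  forLoop 0 (.arr 0 (.const 1)) (.block [.assign 10 (.reg 0), .assign 3 (edgeField 4),
    .assign 2 (edgeField 2), addColour, .assign 2 (edgeField 3), addColour])

/-- Adds the colour `c` to the colours of the vertex in register `2` if these are fewer than two. -/
def padColour (c : ℕ) : Program :=
  .block [.assign 3 (.const c), .cond (.lt (.arr 4 (.reg 2)) (.const 2)) addColour .skip]

/-- Adds the padding colours. -/
def padProg : Program :=
  forLoop 0 (.arr 0 (.const 0)) (.block [.assign 2 (.reg 0), padColour 1, padColour 2])

/-- The arrays `2`, `3`, `4` and the register `7` of the state represent the lists `L v` of distinct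
colours below `B`. -/
structure Colours {V : Type*} {p : ℕ} (lab : Fin p ≃ V) (B : ℕ) (L : V → List ℕ+) (s : State) :
    Prop where
  len : ∀ v, s.arr 4 (lab.symm v) = (L v).length
  row : ∀ v i (h : i < (L v).length), s.arr 3 (lab.symm v * B + i) = (L v)[i]
  flag : ∀ v (c : ℕ+), (c : ℕ) < B → (s.arr 2 (lab.symm v * B + c) = 0 ↔ c ∉ L v)
  nodup : ∀ v, (L v).Nodup
  lt : ∀ v, ∀ c ∈ L v, (c : ℕ) < B
  total : s.reg 7 = ∑ i, (L (lab i)).length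

/-- Adds a colour at the end of a list unless it is already there. -/
def addNew (l : List ℕ+) (c : ℕ+) : List ℕ+ := if c ∈ l then l else l ++ [c]

theorem mem_addNew {l : List ℕ+} {c d : ℕ+} : d ∈ addNew l c ↔ d ∈ l ∨ d = c := by
  unfold addNew
  split_ifs with h
  · constructor
    · exact Or.inl
    · rintro (h' | rfl)
      · exact h'
      · exact h
  · simp

theorem addNew_nodup {l : List ℕ+} {c : ℕ+} (h : l.Nodup) : (addNew l c).Nodup := by
  unfold addNew
  split_ifs with hc
  · exact h
  · rw [List.nodup_append]
    refine ⟨h, by simp, ?_⟩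
    rintro a ha b hb rfl
    rw [List.mem_singleton] at hb
    exact hc (hb ▸ ha)

theorem length_lt_of_nodup {l : List ℕ+} {B : ℕ} (hB : 0 < B) (h : l.Nodup)
    (hl : ∀ c ∈ l, (c : ℕ) < B) : l.length < B := by
  have hsub : (l.map PNat.val).toFinset ⊆ Finset.Ioo 0 B := by
    intro x hx
    obtain ⟨c, hc, rfl⟩ := List.mem_map.1 (List.mem_toFinset.1 hx)
    exact Finset.mem_Ioo.2 ⟨c.pos, hl c hc⟩
  have := Finset.card_le_card hsub
  rw [List.toFinset_card_of_nodup (h.map PNat.coe_injective), List.length_map,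
    Nat.card_Ioo] at this
  omega

section Colours

variable {V : Type*} {p : ℕ} {lab : Fin p ≃ V} {B : ℕ} {L : V → List ℕ+} {s : State}

theorem Colours.of_reg (h : Colours lab B L s) {x : ℕ} (hx : x ≠ 7) (y : ℕ) :
    Colours lab B L { s with reg := Function.update s.reg x y } :=
  ⟨h.len, h.row, h.flag, h.nodup, h.lt, (Function.update_of_ne hx.symm _ _).trans h.total⟩

variable [DecidableEq V]

theorem wp_addColour {v : V} {c : ℕ+} (h2 : s.reg 2 = lab.symm v) (h3 : s.reg 3 = c)
    (hc : (c : ℕ) < B) (hb : ∀ i < p, s.arr 1 i = i * B) (h : Colours lab B L s) :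
    Wp addColour (fun t s' => t ≤ 40 ∧
      Colours lab B (Function.update L v (addNew (L v) c)) s') s := by
  have hbv : s.arr 1 (lab.symm v) = lab.symm v * B := hb _ (lab.symm v).2
  by_cases hm : c ∈ L v
  · have hadd : addNew (L v) c = L v := if_pos hm
    rw [hadd, Function.update_eq_self]
    refine wp_cond_false ?_ ?_
    · have : s.arr 2 (lab.symm v * B + c) ≠ 0 := fun h0 => (h.flag v c hc).1 h0 hm
      simp [Expr.eval, keyExpr, h2, h3, hbv, this]
    · rw [wp_skip]
      exact ⟨by simp [Expr.cost, keyExpr], h⟩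
  · have hnd : (L v ++ [c]).Nodup := by
      have := addNew_nodup (c := c) (h.nodup v)
      rwa [addNew, if_neg hm] at this
    have hlt : ∀ d ∈ L v ++ [c], (d : ℕ) < B := by
      simp only [List.mem_append, List.mem_singleton]
      rintro d (hd | rfl)
      · exact h.lt v d hd
      · exact hc
    have hB : 0 < B := by omega
    have hlen : (L v).length < B := length_lt_of_nodup hB (h.nodup v) (h.lt v)
    rw [show addNew (L v) c = L v ++ [c] from if_neg hm]
    refine wp_cond_true ?_ ?_
    · have : s.arr 2 (lab.symm v * B + c) = 0 := (h.flag v c hc).2 hm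
      simp [Expr.eval, keyExpr, h2, h3, hbv, this]
    · simp only [wp_block_cons, wp_assign, wp_store, wp_block_nil, Expr.eval, Expr.cost, keyExpr,
        ne_eq, Nat.reduceEqDiff,
        OfNat.one_ne_ofNat, not_false_eq_true, Function.update_of_ne, h2, h3, hbv, h.len v]
      refine ⟨by omega, ?_⟩
      constructor
      · intro u
        by_cases hu : u = v
        · subst hu; simp
        · have : ((lab.symm u : Fin p) : ℕ) ≠ (lab.symm v : Fin p) := by
            simpa [Fin.val_inj] using hu
          simp [hu, this, h.len u]
      · intro u i hi
        have hinj : ∀ j < B, (lab.symm u * B + j = lab.symm v * B + (L v).length ↔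
            u = v ∧ j = (L v).length) := by
          intro j hj
          rw [key_inj hj hlen]; simp [Fin.val_inj]
        by_cases hu : u = v
        · subst hu
          simp only [Function.update_self, List.length_append, List.length_singleton] at hi
          simp only [Function.update_self, ne_eq, Nat.reduceEqDiff,
        not_false_eq_true, Function.update_of_ne]
          rcases Nat.lt_succ_iff_lt_or_eq.1 hi with hi | rfl
          · rw [Function.update_of_ne (by simp [hi.ne]), h.row u i hi,
              List.getElem_append_left hi]
          · simp
        · simp only [Function.update_of_ne hu] at hi ⊢
          have := length_lt_of_nodup hB (h.nodup u) (h.lt u)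
          simp only [Function.update_self, ne_eq, Nat.reduceEqDiff,
        not_false_eq_true, Function.update_of_ne]
          rw [Function.update_of_ne (by simp [hinj i (by omega), hu]), h.row u i hi]
      · intro u d hd
        simp only [Function.update_self]
        by_cases hud : u = v ∧ d = c
        · obtain ⟨rfl, rfl⟩ := hud
          simp
        · rw [Function.update_of_ne, h.flag u d hd]
          · by_cases hu : u = v
            · subst hu
              have : d ≠ c := fun h => hud ⟨rfl, h⟩
              simp [this]
            · simp [hu]
          · rw [ne_eq, key_inj hd hc]
            simpa [Fin.val_inj, PNat.coe_inj] using hud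
      · intro u
        by_cases hu : u = v
        · subst hu; simpa using hnd
        · simpa [hu] using h.nodup u
      · intro u
        by_cases hu : u = v
        · subst hu; simpa using hlt
        · simpa [hu] using h.lt u
      · have : ∀ i, (Function.update L v (L v ++ [c]) (lab i)).length =
            (L (lab i)).length + if i = lab.symm v then 1 else 0 := by
          intro i
          by_cases hi : lab i = v
          · subst hi; simp
          · have : i ≠ lab.symm v := fun h => hi (by simp [h])
            simp [hi, this]
        simp only [this, Finset.sum_add_distrib, Finset.sum_ite_eq', Finset.mem_univ, if_true,
          h.total, Function.update_self]

/-- The effect of `padColour` on the list of colours of a vertex. -/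
def padList (l : List ℕ+) (c : ℕ+) : List ℕ+ := if l.length < 2 then addNew l c else l

theorem wp_padColour {v : V} (c : ℕ+) (h2 : s.reg 2 = lab.symm v) (hc : (c : ℕ) < B)
    (hb : ∀ i < p, s.arr 1 i = i * B) (h : Colours lab B L s) :
    Wp (padColour c) (fun t s' => t ≤ 60 ∧
      Colours lab B (Function.update L v (padList (L v) c)) s') s := by
  rw [padColour, wp_block_cons, wp_assign, wp_block_cons]
  have hL := h.of_reg (x := 3) (by decide) ((Expr.const c).eval s)
  by_cases hlen : (L v).length < 2
  · refine wp_cond_true (by simp [Expr.eval, h2, h.len, hlen]) ?_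
    refine Wp.mono (wp_addColour (B := B) (v := v) (c := c) (by simpa using h2)
      (by simp [Expr.eval]) hc hb hL) ?_
    rintro t s' ⟨ht, h'⟩
    rw [wp_block_nil, padList, if_pos hlen]
    exact ⟨by simp only [Expr.cost]; omega, h'⟩
  · refine wp_cond_false (by simpa [Expr.eval, h2, h.len] using hlen) ?_
    rw [wp_skip, wp_block_nil, padList, if_neg hlen, Function.update_eq_self]
    exact ⟨by simp [Expr.cost], hL⟩

variable [PartialOrder V] {φ : HasseEdge V → ℕ+} {edges : List (HasseEdge V)}

theorem wp_colourProg (hs : s.arr 0 = inputArr lab φ edges) (hB : ∀ e ∈ edges, (φ e : ℕ) < B)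
    (hb : ∀ i < p, s.arr 1 i = i * B) (h2 : ∀ i, s.arr 2 i = 0) (h4 : ∀ i, s.arr 4 i = 0)
    (h7 : s.reg 7 = 0) :
    Wp colourProg (fun t s' => t ≤ 200 * (edges.length + 1) ∧ ∃ L, Colours lab B L s' ∧
      ∀ v c, c ∈ L v ↔ ∃ e ∈ edges, (e.src = v ∨ e.tgt = v) ∧ φ e = c) s := by
  refine (wp_forLoop edges.length (fun k T s => T ≤ 200 * k ∧ ∃ L, Colours lab B L s ∧
      ∀ v c, c ∈ L v ↔ ∃ e ∈ edges.take k, (e.src = v ∨ e.tgt = v) ∧ φ e = c)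
    ?_ (by decide) ?_ ?_ ?_).mono ?_
  · rintro k T s y ⟨hT, L, hL, h⟩
    exact ⟨hT, L, hL.of_reg (by decide) y, h⟩
  · exact ⟨by simp, fun _ => [], ⟨by simp [h4], by simp, by simp [h2], by simp, by simp,
      by simp [h7]⟩, by simp⟩
  · rintro k T s' hk hf hx ⟨hT, L, hL, h⟩
    have harr : s'.arr 0 = inputArr lab φ edges := (hf.arr 0 (by decide)).trans hs
    have hb' : ∀ i < p, s'.arr 1 i = i * B := by rwa [hf.arr 1 (by decide)]
    have hc := hB _ (List.getElem_mem hk)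
    simp only [wp_block_cons, wp_assign, edgeField, Expr.eval, Expr.cost, harr, hx,
      Function.update_self, ne_eq, Nat.reduceEqDiff,
        not_false_eq_true, Function.update_of_ne, inputArr_colour lab φ hk, inputArr_src lab φ hk]
    refine Wp.mono (Wp.frame (wp_addColour (B := B) (L := L) (v := edges[k].src) (c := φ edges[k])
      (by simp) (by simp) hc hb'
      (((hL.of_reg (by decide) _).of_reg (by decide) _).of_reg (by decide) _))) ?_
    rintro t s₁ ⟨⟨ht, hL₁⟩, hf₁⟩
    have harr₁ : s₁.arr 0 = inputArr lab φ edges := (hf₁.arr 0 (by decide)).trans harr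
    have hb₁ : ∀ i < p, s₁.arr 1 i = i * B := by rw [hf₁.arr 1 (by decide)]; exact hb'
    have h10 : s₁.reg 10 = k := (hf₁.reg 10 (by decide)).trans (by simp)
    have h3 : s₁.reg 3 = φ edges[k] := (hf₁.reg 3 (by decide)).trans (by simp)
    simp only [harr₁, h10, inputArr_tgt lab φ hk]
    refine Wp.mono (wp_addColour (B := B) (v := edges[k].tgt) (c := φ edges[k]) (by simp)
      (by simpa using h3) hc hb₁ (hL₁.of_reg (by decide) _)) ?_
    rintro t' s₂ ⟨ht', hL₂⟩
    rw [wp_block_nil]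
    refine ⟨by omega, _, hL₂, ?_⟩
    intro v c
    have hmem : ∀ (L : V → List ℕ+) u, c ∈ Function.update L u (addNew (L u) (φ edges[k])) v ↔
        c ∈ L v ∨ (u = v ∧ φ edges[k] = c) := by
      intro L u
      by_cases hu : v = u
      · subst hu; simp [mem_addNew, eq_comm]
      · simp [hu, Ne.symm hu]
    rw [hmem, hmem, h v c, List.take_succ_eq_append_getElem hk]
    simp only [List.mem_append, List.mem_singleton, or_and_right, exists_or, exists_eq_left,
      or_assoc]
  · intro s' hf
    have harr : s'.arr 0 = inputArr lab φ edges := (hf.arr 0 (by decide)).trans hs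
    simp [Expr.eval, harr, inputArr_one]
  · rintro t s' ⟨T, ⟨hT, L, hL, h⟩, rfl⟩
    rw [List.take_length] at h
    exact ⟨by simp only [Expr.cost]; omega, L, hL, h⟩

theorem wp_padProg {L : V → List ℕ+} (hs : s.arr 0 = inputArr lab φ edges) (hB : 3 ≤ B)
    (hb : ∀ i < p, s.arr 1 i = i * B) (hL : Colours lab B L s) :
    Wp padProg (fun t s' => t ≤ 200 * (p + 1) ∧
      Colours lab B (fun v => padList (padList (L v) 1) 2) s') s := by
  refine (wp_forLoop p (fun k T s => T ≤ 200 * k ∧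
    Colours lab B (fun v => if (lab.symm v : ℕ) < k then padList (padList (L v) 1) 2 else L v) s)
    ?_ (by decide) ?_ ?_ ?_).mono ?_
  · rintro k T s y ⟨hT, hL⟩
    exact ⟨hT, hL.of_reg (by decide) y⟩
  · simpa using hL
  · rintro k T s' hk hf hx ⟨hT, hL'⟩
    have hb' : ∀ i < p, s'.arr 1 i = i * B := by rwa [hf.arr 1 (by decide)]
    obtain ⟨v, hv⟩ : ∃ v, (lab.symm v : ℕ) = k := ⟨lab ⟨k, hk⟩, by simp⟩
    simp only [wp_block_cons, wp_assign, Expr.eval, Expr.cost, hx]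
    refine Wp.mono (Wp.frame (wp_padColour 1 (v := v) (by simp [hv]) (by simp; omega) hb'
      (hL'.of_reg (by decide) _))) ?_
    rintro t s₁ ⟨⟨ht, hL₁⟩, hf₁⟩
    have hb₁ : ∀ i < p, s₁.arr 1 i = i * B := by rw [hf₁.arr 1 (by decide)]; exact hb'
    have h2 : s₁.reg 2 = lab.symm v := (hf₁.reg 2 (by decide)).trans (by simp [hv])
    refine (wp_padColour 2 (v := v) h2 (by simp; omega) hb₁ hL₁).mono ?_
    rintro t' s₂ ⟨ht', hL₂⟩
    rw [wp_block_nil]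
    refine ⟨by omega, ?_⟩
    convert hL₂ using 1
    funext u
    by_cases hu : u = v
    · subst hu; simp [hv]
    · have : (lab.symm u : ℕ) ≠ k := by
        rw [← hv]; simpa [Fin.val_inj] using hu
      have : (lab.symm u : ℕ) < k + 1 ↔ (lab.symm u : ℕ) < k := by omega
      simp [hu, this]
  · intro s' hf
    have harr : s'.arr 0 = inputArr lab φ edges := (hf.arr 0 (by decide)).trans hs
    simp [Expr.eval, harr, inputArr_zero]
  · rintro t s' ⟨T, ⟨hT, hL⟩, rfl⟩
    refine ⟨by simp only [Expr.cost]; omega, ?_⟩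
    simpa using hL

end Colours

theorem padList_of_two_le {l : List ℕ+} {c : ℕ+} (h : 2 ≤ l.length) : padList l c = l :=
  if_neg (by omega)

theorem padList_padList {l : List ℕ+} (h : l.length < 2) :
    (padList (padList l 1) 2).length = 2 ∧ (∀ c ∈ l, c ∈ padList (padList l 1) 2) ∧
      ∀ c ∈ padList (padList l 1) 2, c ∈ l ∨ c = 1 ∨ c = 2 := by
  have h12 : (2 : ℕ+) ≠ 1 := by decide
  match l, h with
  | [], _ => simp [padList, addNew]
  | [a], _ =>
    by_cases ha : a = 1
    · subst ha; simp [padList, addNew]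
    · simp [padList, addNew, Ne.symm ha]

/-! ### The program: the edges at each agent -/

/-- `x` is the head of the linked list of the numbers in `l`, where `e + 1` stands for a reference
to `e`, where `0` is the empty reference, and where `nxt e` refers to the successor of `e`. -/
def Chain (nxt : ℕ → ℕ) : ℕ → List ℕ → Prop
  | x, [] => x = 0
  | x, e :: l => x = e + 1 ∧ Chain nxt (nxt e) l

theorem Chain.congr {nxt nxt' : ℕ → ℕ} {l : List ℕ} {x : ℕ} (h : Chain nxt x l)
    (he : ∀ e ∈ l, nxt' e = nxt e) : Chain nxt' x l := by
  induction l generalizing x with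
  | nil => exact h
  | cons e l ih =>
    refine ⟨h.1, ?_⟩
    rw [he e (by simp)]
    exact ih h.2 fun e' he' => he e' (by simp [he'])

/-- The arrays `a`, `a + 1` and `a + 2` hold, for each key `κ`, the head, the links and the length
of a linked list of those members of `done` that have the key `κ`. -/
def Linked (arr : ℕ → ℕ → ℕ) (a : ℕ) (key : ℕ → ℕ) (done : List ℕ) : Prop :=
  ∀ κ, Chain (arr (a + 1)) (arr a κ) (done.filter fun e => key e = κ) ∧
    arr (a + 2) κ = (done.filter fun e => key e = κ).length

/-- The key of the edge number `e`: that of its colour and of its lower endpoint, if `k = 2`, or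
its upper endpoint, if `k = 3`. -/
def edgeKey (arr : ℕ → ℕ → ℕ) (k e : ℕ) : ℕ :=
  arr 1 (arr 0 (e + e + (e + k))) + arr 0 (e + e + (e + 4))

/-- Puts the edge whose number is the value of `ix` at the front of its linked list. -/
def linkEdge (a k : ℕ) (ix : Expr) : Program :=
  .block [.assign 10 ix, .assign 5 (.add (.arr 1 (edgeField k)) (edgeField 4)),
    .store (a + 1) (.reg 10) (.arr a (.reg 5)), .store a (.reg 5) (.add (.reg 10) (.const 1)),
    .store (a + 2) (.reg 5) (.add (.arr (a + 2) (.reg 5)) (.const 1))]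

/-- Puts all edges into linked lists. -/
def linkProg (a k : ℕ) (ix : Expr) : Program := forLoop 0 (.arr 0 (.const 1)) (linkEdge a k ix)

theorem wp_linkEdge {a k e : ℕ} {ix : Expr} {s : State} {done : List ℕ} (hix : ix.eval s = e)
    (he : e ∉ done) (h : Linked s.arr a (edgeKey s.arr k) done) :
    Wp (linkEdge a k ix) (fun t s' => t ≤ 60 + ix.cost ∧
      Linked s'.arr a (edgeKey s.arr k) (e :: done)) s := by
  set κ₀ := edgeKey s.arr k e with hκ
  have hne1 : a + 1 ≠ a := by omega
  have hne2 : a + 2 ≠ a := by omega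
  have hne3 : a + 2 ≠ a + 1 := by omega
  simp only [linkEdge, wp_block_cons, wp_assign, wp_store, wp_block_nil, Expr.eval, Expr.cost,
    edgeField, hix, Function.update_self, ne_eq, Nat.reduceEqDiff, not_false_eq_true,
    Function.update_of_ne, hne2, hne3, hne1.symm]
  refine ⟨by omega, fun κ => ?_⟩
  simp only [← edgeKey.eq_def, ← hκ, Function.update_self, ne_eq, not_false_eq_true,
    Function.update_of_ne, hne1, hne2.symm, hne3.symm]
  obtain ⟨h1, h2⟩ := h κ
  have hcongr : ∀ x y, Chain (s.arr (a + 1)) x (done.filter fun e => edgeKey s.arr k e = κ) →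
      Chain (Function.update (s.arr (a + 1)) e y) x
        (done.filter fun e => edgeKey s.arr k e = κ) := fun x y hx =>
    hx.congr fun e' he' => Function.update_of_ne
      (fun heq : e' = e => he (heq ▸ (List.mem_filter.1 he').1)) _ _
  by_cases hkey : edgeKey s.arr k e = κ
  · rw [List.filter_cons_of_pos (by simpa using hkey)]
    obtain rfl : κ₀ = κ := hkey
    refine ⟨⟨by simp, ?_⟩, by simpa using h2⟩
    rw [Function.update_self]
    exact hcongr _ _ h1
  · rw [List.filter_cons_of_neg (by simpa using hkey)]
    have hκ' : κ ≠ κ₀ := fun h => hkey h.symm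
    rw [Function.update_of_ne hκ', Function.update_of_ne hκ']
    exact ⟨hcongr _ _ h1, h2⟩

section Link

variable {V : Type*} [PartialOrder V] {p : ℕ} {lab : Fin p ≃ V} {φ : HasseEdge V → ℕ+}
  {edges : List (HasseEdge V)} {s : State}

/-- The numbers of the edges are processed in the order `idx 0, idx 1, …`, and `done k` lists the
first `k` of them, the last one first. -/
theorem wp_linkProg {a k : ℕ} {ix : Expr} (ha : 2 ≤ a) {idx : ℕ → ℕ} {done : ℕ → List ℕ}
    (hs : s.arr 0 = inputArr lab φ edges)
    (hix : ∀ (s' : State) j, s'.arr 0 = s.arr 0 → s'.reg 0 = j → ix.eval s' = idx j)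
    (hd0 : done 0 = []) (hd : ∀ j < edges.length, done (j + 1) = idx j :: done j)
    (hnot : ∀ j < edges.length, idx j ∉ done j)
    (h0 : ∀ b, a ≤ b → ∀ i, s.arr b i = 0) :
    Wp (linkProg a k ix) (fun t s' => t ≤ (80 + ix.cost) * (edges.length + 1) ∧
      Linked s'.arr a (edgeKey s.arr k) (done edges.length)) s := by
  have hregs : 0 ∉ (linkEdge a k ix).regs := by
    simp [linkEdge, Program.block, Program.regs]
  have harrs : ∀ b < 2, b ∉ (linkProg a k ix).arrs := by
    intro b hb
    simp only [linkProg, forLoop, linkEdge, Program.block, Program.arrs, List.append_nil,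
      List.nil_append, List.cons_append, List.mem_cons, List.not_mem_nil, or_false, not_or]
    omega
  refine (wp_forLoop edges.length (fun j T s' => T ≤ (80 + ix.cost) * j ∧
    Linked s'.arr a (edgeKey s.arr k) (done j)) ?_ hregs ?_ ?_ ?_).mono ?_
  · intro j T s' y h; exact h
  · refine ⟨by simp, fun κ => ?_⟩
    rw [hd0]
    exact ⟨h0 a le_rfl κ, h0 (a + 2) (by omega) κ⟩
  · rintro j T s' hj hf hx ⟨hT, h⟩
    have e0 : s'.arr 0 = s.arr 0 := hf.arr 0 (harrs 0 (by omega))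
    have e1 : s'.arr 1 = s.arr 1 := hf.arr 1 (harrs 1 (by omega))
    have hkey : edgeKey s'.arr k = edgeKey s.arr k := by
      funext e; simp only [edgeKey, e0, e1]
    refine Wp.mono (wp_linkEdge (hix s' j e0 hx) (hnot j hj) (hkey ▸ h)) ?_
    rintro t s₁ ⟨ht, hl⟩
    rw [hd j hj, ← hkey]
    refine ⟨?_, hl⟩
    simp only [Expr.cost]
    rw [Nat.mul_add]
    omega
  · intro s' hf
    have : s'.arr 0 = s.arr 0 := hf.arr 0 (harrs 0 (by omega))
    simp [Expr.eval, this, hs, inputArr_one]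
  · rintro t s' ⟨T, ⟨hT, h⟩, rfl⟩
    refine ⟨?_, h⟩
    simp only [Expr.cost]
    rw [Nat.mul_add]
    omega

end Link

/-- The positions of a list that satisfy a property of its members may be used in place of these
members. -/
theorem flatMap_filter_range {α β : Type*} (l : List α) {P : α → Bool} {Q : ℕ → Bool}
    {f : α → List β} {g : ℕ → List β} (hP : ∀ i (h : i < l.length), Q i = P l[i])
    (hf : ∀ i (h : i < l.length), g i = f l[i]) :
    ((List.range l.length).filter Q).flatMap g = (l.filter P).flatMap f ∧
    ((List.range l.length).filter Q).reverse.flatMap g = (l.filter P).reverse.flatMap f ∧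
    ((List.range l.length).filter Q).length = (l.filter P).length := by
  have h1 : (List.range l.length).filter Q =
      ((List.finRange l.length).filter fun i => P l[i]).map Fin.val := by
    rw [← List.map_coe_finRange_eq_range, List.filter_map]
    congr 1
    exact List.filter_congr fun i _ => hP i i.2
  have h2 : l.filter P = ((List.finRange l.length).filter fun i => P l[i]).map l.get := by
    conv_lhs => rw [← List.map_get_finRange l]
    rw [List.filter_map]
    rfl
  rw [h1, h2, ← List.map_reverse, ← List.map_reverse]
  simp only [List.flatMap_map, List.length_map, and_true]
  exact ⟨List.flatMap_congr fun i _ => hf i i.2, List.flatMap_congr fun i _ => hf i i.2⟩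

/-! ### The program: output -/

/-- Writes the linked list that starts in register `6`: for each edge, the colour in register `3`
and an endpoint, the lower one if `k = 1` and the upper one if `k = 0`. -/
def emitChain (a k : ℕ) : Program :=
  .loop (.reg 6) (.block [.emit (.reg 3),
    .emit (.arr 0 (.add (.reg 6) (.add (.reg 6) (.sub (.reg 6) (.const k))))),
    .assign 6 (.arr (a + 1) (.sub (.reg 6) (.const 1)))])

theorem wp_emitChain {a k : ℕ} {s : State} {l : List ℕ} (h : Chain (s.arr (a + 1)) (s.reg 6) l) :
    Wp (emitChain a k) (fun t s' => t ≤ 20 * l.length + 2 ∧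
      s'.out = s.out ++ l.flatMap fun e =>
        [s.reg 3, s.arr 0 (e + 1 + (e + 1 + (e + 1 - k)))]) s := by
  induction l generalizing s with
  | nil => exact wp_loop_false h ⟨by simp [Expr.cost], by simp⟩
  | cons e l ih =>
    obtain ⟨h6, h⟩ := h
    refine wp_loop_true (by simp [Expr.eval, h6]) ?_
    simp only [wp_block_cons, wp_assign, wp_emit, wp_block_nil, Expr.eval, Expr.cost, h6]
    refine Wp.mono (ih (by simpa using h)) ?_
    rintro t s' ⟨ht, hout⟩
    refine ⟨by rw [List.length_cons]; omega, ?_⟩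
    rw [hout]
    simp

/-- Writes the man of the vertex in register `0` whose colour has the position in register `1`,
with his preference list. -/
def emitMan : Program :=
  .block [.assign 8 (.arr 1 (.reg 0)), .assign 3 (.arr 3 (.add (.reg 8) (.reg 1))),
    .assign 5 (.add (.reg 8) (.reg 3)), .emit (.reg 3), .emit (.reg 0),
    .emit (.add (.arr 10 (.reg 5)) (.const 2)), .emit (.reg 3), .emit (.reg 0),
    .assign 6 (.arr 8 (.reg 5)), emitChain 8 1,
    .cond (.lt (.add (.reg 1) (.const 1)) (.arr 4 (.reg 0)))
      (.emit (.arr 3 (.add (.reg 8) (.add (.reg 1) (.const 1))))) (.emit (.arr 3 (.reg 8))),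
    .emit (.reg 0)]

/-- Writes the woman of the vertex in register `0` whose colour has the position in register `1`,
with her preference list. -/
def emitWoman : Program :=
  .block [.assign 8 (.arr 1 (.reg 0)), .assign 3 (.arr 3 (.add (.reg 8) (.reg 1))),
    .assign 5 (.add (.reg 8) (.reg 3)), .emit (.reg 3), .emit (.reg 0),
    .emit (.add (.arr 7 (.reg 5)) (.const 2)),
    .cond (.reg 1) (.emit (.arr 3 (.add (.reg 8) (.sub (.reg 1) (.const 1)))))
      (.emit (.arr 3 (.add (.reg 8) (.sub (.arr 4 (.reg 0)) (.const 1))))),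
    .emit (.reg 0), .assign 6 (.arr 5 (.reg 5)), emitChain 5 0, .emit (.reg 3), .emit (.reg 0)]

/-- Runs `P` for all vertices and the positions of their colours. -/
def forAgents (P : Program) : Program :=
  forLoop 0 (.arr 0 (.const 0)) (forLoop 1 (.arr 4 (.reg 0)) P)

theorem length_encodeList {V : Type*} {p : ℕ} (lab : Fin p ≃ V) (a : Name V) (l : List (Name V)) :
    (encodeList lab a l).length = 3 + 2 * l.length := by
  have : (l.flatMap (encodeName lab)).length = 2 * l.length := by
    induction l with
    | nil => rfl
    | cons x l ih => rw [List.flatMap_cons, List.length_append, ih]; simp [encodeName]; omega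
  simp only [encodeList, List.length_append, List.length_cons, this]
  simp [encodeName]; omega

section Output

variable {V : Type*} [PartialOrder V] {p : ℕ} {lab : Fin p ≃ V} {φ : HasseEdge V → ℕ+}
  {ch : Choices φ} {arr : ℕ → ℕ → ℕ} {B : ℕ} {s : State}

/-- The contents of the arrays from which the output is written. -/
structure Tables (lab : Fin p ≃ V) (ch : Choices φ) (B : ℕ) (arr : ℕ → ℕ → ℕ) : Prop where
  input : arr 0 = inputArr lab φ ch.edges
  base : ∀ i < p, arr 1 i = i * B
  len : ∀ v, arr 4 (lab.symm v) = (ch.ord v).length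
  row : ∀ v i (h : i < (ch.ord v).length), arr 3 (lab.symm v * B + i) = (ch.ord v)[i]
  lt : ∀ v, ∀ c ∈ ch.C v, (c : ℕ) < B
  out : Linked arr 5 (edgeKey arr 2) (List.range ch.edges.length).reverse
  inn : Linked arr 8 (edgeKey arr 3) (List.range ch.edges.length)

theorem succColour_getElem (ch : Choices φ) (v : V) {i : ℕ} (hi : i < (ch.ord v).length) :
    succColour ch v (ch.ord v)[i] =
      (ch.ord v)[(i + 1) % (ch.ord v).length]'(Nat.mod_lt _ (by omega)) :=
  List.formPerm_apply_getElem _ (ch.ord_nodup v) i hi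

/-- The time is charged to the output: `hP` bounds each round of the inner loop by a multiple of
what it writes. -/
theorem wp_forAgents {P : Program} {G : ℕ+ → V → List ℕ} (h : Tables lab ch B s.arr)
    (harrs : P.arrs = []) (hr0 : 0 ∉ P.regs) (hr1 : 1 ∉ P.regs)
    (hP : ∀ (s : State) (v : V) (i : ℕ) (hi : i < (ch.ord v).length), Tables lab ch B s.arr →
      s.reg 0 = lab.symm v → s.reg 1 = i → Wp P (fun t s' =>
        t ≤ 20 * (G (ch.ord v)[i] v).length ∧ s'.out = s.out ++ G (ch.ord v)[i] v) s)
    (hG : ∀ c v, 1 ≤ (G c v).length) :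
    Wp (forAgents P) (fun t s' => ∃ l, s'.out = s.out ++ l ∧
      l = ((List.finRange p).flatMap fun i => (ch.ord (lab i)).flatMap fun c => G c (lab i)) ∧
      t ≤ 40 * l.length + 40 * (p + 1)) s := by
  have hF : ∀ {s₀ s' : State}, Frame (forLoop 1 (.arr 4 (.reg 0)) P) s₀ s' →
      s'.arr = s₀.arr ∧ s'.reg 0 = s₀.reg 0 := by
    intro s₀ s' hf
    exact ⟨funext fun a => hf.arr a (by simp [forLoop, Program.block, Program.arrs, harrs]),
      hf.reg 0 (by simp [forLoop, Program.block, Program.regs, hr0])⟩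
  let F : Fin p → List ℕ := fun i => (ch.ord (lab i)).flatMap fun c => G c (lab i)
  refine (wp_forLoop p (fun k T s' =>
    s'.out = s.out ++ ((List.finRange p).take k).flatMap F ∧
    T ≤ 40 * (((List.finRange p).take k).flatMap F).length + 40 * k) ?_ ?_ ?_ ?_ ?_).mono ?_
  · intro k T s' y h; exact h
  · simp [forLoop, Program.block, Program.regs, hr0]
  · simp
  · rintro k T s' hk hf hx ⟨hout, hT⟩
    have harr : s'.arr = s.arr := funext fun a =>
      hf.arr a (by simp [forLoop, Program.block, Program.arrs, harrs])
    have hv : (lab.symm (lab ⟨k, hk⟩) : ℕ) = k := by simp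
    set v := lab ⟨k, hk⟩ with hvdef
    have htake : (List.finRange p).take (k + 1) = (List.finRange p).take k ++ [⟨k, hk⟩] := by
      rw [List.take_succ_eq_append_getElem (by simpa using hk)]
      simp
    refine Wp.mono (wp_forLoop (s₀ := s') (ch.ord v).length (fun j T' s₁ =>
      s₁.out = s'.out ++ ((ch.ord v).take j).flatMap (fun c => G c v) ∧
      T' ≤ 40 * (((ch.ord v).take j).flatMap (fun c => G c v)).length) ?_ hr1 ?_ ?_ ?_) ?_
    · intro k T s' y h; exact h
    · simp
    · rintro j T' s₁ hj hf₁ hx₁ ⟨hout₁, hT₁⟩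
      obtain ⟨e1, e2⟩ := hF hf₁
      refine Wp.mono (hP s₁ v j hj (by rw [e1, harr]; exact h) (by rw [e2, hx, hv]) hx₁) ?_
      rintro t s₂ ⟨ht, hout₂⟩
      have := hG (ch.ord v)[j] v
      rw [List.take_succ_eq_append_getElem hj, List.flatMap_append]
      refine ⟨by rw [hout₂, hout₁]; simp, ?_⟩
      simp only [List.length_append, List.flatMap_cons, List.flatMap_nil, List.append_nil,
        Expr.cost]
      omega
    · intro s₁ hf₁
      obtain ⟨e1, e2⟩ := hF hf₁
      simp only [Expr.eval, e1, e2, hx, harr]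
      rw [← hv]; exact h.len v
    · rintro t s₁ ⟨T', ⟨hout₁, hT₁⟩, rfl⟩
      rw [List.take_length] at hout₁ hT₁
      rw [htake, List.flatMap_append]
      have hFk : F ⟨k, hk⟩ = (ch.ord v).flatMap fun c => G c v := rfl
      refine ⟨by rw [hout₁, hout]; simp [hFk], ?_⟩
      simp only [List.length_append, List.flatMap_cons, List.flatMap_nil, List.append_nil,
        Expr.cost, hFk]
      omega
  · intro s' hf
    have harr : s'.arr = s.arr := funext fun a =>
      hf.arr a (by simp [forLoop, Program.block, Program.arrs, harrs])
    simp [Expr.eval, harr, h.input, inputArr_zero]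
  · rintro t s' ⟨T, ⟨hout, hT⟩, rfl⟩
    have hlen : (List.finRange p).take p = List.finRange p := List.take_of_length_le (by simp)
    rw [hlen] at hout hT
    refine ⟨_, hout, rfl, ?_⟩
    simp only [Expr.cost]
    omega

variable [DecidableEq V]

theorem Tables.chain_in (h : Tables lab ch B arr) {v : V} {c : ℕ+} (hc : c ∈ ch.C v) :
    ∃ l, Chain (arr 9) (arr 8 (lab.symm v * B + c)) l ∧
      arr 10 (lab.symm v * B + c) = (inEdges ch c v).length ∧
      l.length = (inEdges ch c v).length ∧
      (l.flatMap fun e => [(c : ℕ), arr 0 (e + 1 + (e + 1 + (e + 1 - 1)))]) =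
        (inEdges ch c v).flatMap fun e => [(c : ℕ), lab.symm e.src] := by
  obtain ⟨h1, h2⟩ := h.inn (lab.symm v * B + c)
  have hP : ∀ i (hi : i < ch.edges.length),
      decide (edgeKey arr 3 i = lab.symm v * B + c) =
        decide (ch.edges[i].tgt = v ∧ φ ch.edges[i] = c) := by
    intro i hi
    rw [decide_eq_decide, edgeKey, h.input, inputArr_tgt lab φ hi, inputArr_colour lab φ hi,
      h.base _ (Fin.is_lt _),
      key_inj (h.lt _ _ (ch.colour_mem_tgt _)) (h.lt _ _ hc), Fin.val_inj, PNat.coe_inj,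
      Equiv.apply_eq_iff_eq]
  have hf : ∀ i (hi : i < ch.edges.length),
      [(c : ℕ), arr 0 (i + 1 + (i + 1 + (i + 1 - 1)))] =
        [(c : ℕ), (lab.symm ch.edges[i].src : ℕ)] := by
    intro i hi
    rw [show i + 1 + (i + 1 + (i + 1 - 1)) = i + i + (i + 2) by omega, h.input,
      inputArr_src lab φ hi]
  obtain ⟨h3, -, h4⟩ := flatMap_filter_range ch.edges
    (Q := fun e => decide (edgeKey arr 3 e = lab.symm v * B + c))
    (P := fun e => decide (e.tgt = v ∧ φ e = c))
    (g := fun e => [(c : ℕ), arr 0 (e + 1 + (e + 1 + (e + 1 - 1)))])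
    (f := fun e => [(c : ℕ), lab.symm e.src]) hP hf
  exact ⟨_, h1, h2.trans h4, h4, h3⟩

theorem Tables.chain_out (h : Tables lab ch B arr) {v : V} {c : ℕ+} (hc : c ∈ ch.C v) :
    ∃ l, Chain (arr 6) (arr 5 (lab.symm v * B + c)) l ∧
      arr 7 (lab.symm v * B + c) = (outEdges ch c v).length ∧
      l.length = (outEdges ch c v).length ∧
      (l.flatMap fun e => [(c : ℕ), arr 0 (e + 1 + (e + 1 + (e + 1 - 0)))]) =
        (outEdges ch c v).reverse.flatMap fun e => [(c : ℕ), lab.symm e.tgt] := by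
  obtain ⟨h1, h2⟩ := h.out (lab.symm v * B + c)
  rw [List.filter_reverse] at h1 h2
  rw [List.length_reverse] at h2
  have hP : ∀ i (hi : i < ch.edges.length),
      decide (edgeKey arr 2 i = lab.symm v * B + c) =
        decide (ch.edges[i].src = v ∧ φ ch.edges[i] = c) := by
    intro i hi
    rw [decide_eq_decide, edgeKey, h.input, inputArr_src lab φ hi, inputArr_colour lab φ hi,
      h.base _ (Fin.is_lt _),
      key_inj (h.lt _ _ (ch.colour_mem_src _)) (h.lt _ _ hc), Fin.val_inj, PNat.coe_inj,
      Equiv.apply_eq_iff_eq]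
  have hf : ∀ i (hi : i < ch.edges.length),
      [(c : ℕ), arr 0 (i + 1 + (i + 1 + (i + 1 - 0)))] =
        [(c : ℕ), (lab.symm ch.edges[i].tgt : ℕ)] := by
    intro i hi
    rw [show i + 1 + (i + 1 + (i + 1 - 0)) = i + i + (i + 3) by omega, h.input,
      inputArr_tgt lab φ hi]
  obtain ⟨-, h3, h4⟩ := flatMap_filter_range ch.edges
    (Q := fun e => decide (edgeKey arr 2 e = lab.symm v * B + c))
    (P := fun e => decide (e.src = v ∧ φ e = c))
    (g := fun e => [(c : ℕ), arr 0 (e + 1 + (e + 1 + (e + 1 - 0)))])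
    (f := fun e => [(c : ℕ), lab.symm e.tgt]) hP hf
  exact ⟨_, h1, h2.trans h4, (List.length_reverse ..).trans h4, h3⟩

theorem encodeList_manPref {c : ℕ+} {v : V} (hc : c ∈ ch.C v) :
    encodeList lab (c, v) ((constructInstance lab ch).manPref (c, v)) =
      [(c : ℕ), (lab.symm v : ℕ), (inEdges ch c v).length + 2, (c : ℕ), (lab.symm v : ℕ)] ++
        ((inEdges ch c v).flatMap fun e => [(c : ℕ), (lab.symm e.src : ℕ)]) ++
        [(succColour ch v c : ℕ), (lab.symm v : ℕ)] := by
  rw [manPref_eq lab ch hc]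
  simp [encodeList, encodeName, List.flatMap_map]

theorem encodeList_womanPref {c : ℕ+} {v : V} (hc : c ∈ ch.C v) :
    encodeList lab (c, v) ((constructInstance lab ch).womanPref (c, v)) =
      [(c : ℕ), (lab.symm v : ℕ), (outEdges ch c v).length + 2,
        ((succColour ch v).symm c : ℕ), (lab.symm v : ℕ)] ++
        ((outEdges ch c v).reverse.flatMap fun e => [(c : ℕ), (lab.symm e.tgt : ℕ)]) ++
        [(c : ℕ), (lab.symm v : ℕ)] := by
  rw [womanPref_eq lab ch hc]
  simp [encodeList, encodeName, List.flatMap_map, -List.map_reverse]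

theorem length_manPref {c : ℕ+} {v : V} (hc : c ∈ ch.C v) :
    ((constructInstance lab ch).manPref (c, v)).length = (inEdges ch c v).length + 2 := by
  rw [manPref_eq lab ch hc]; simp

theorem length_womanPref {c : ℕ+} {v : V} (hc : c ∈ ch.C v) :
    ((constructInstance lab ch).womanPref (c, v)).length = (outEdges ch c v).length + 2 := by
  rw [womanPref_eq lab ch hc]; simp

theorem wp_emitMan (h : Tables lab ch B s.arr) {v : V} {i : ℕ} (hi : i < (ch.ord v).length)
    (h0 : s.reg 0 = lab.symm v) (h1 : s.reg 1 = i) :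
    Wp emitMan (fun t s' =>
      t ≤ 20 * (encodeList lab ((ch.ord v)[i], v)
        ((constructInstance lab ch).manPref ((ch.ord v)[i], v))).length ∧
      s'.out = s.out ++ encodeList lab ((ch.ord v)[i], v)
        ((constructInstance lab ch).manPref ((ch.ord v)[i], v))) s := by
  have hc : (ch.ord v)[i] ∈ ch.C v := (ch.mem_ord v _).1 (List.getElem_mem hi)
  obtain ⟨l, hl, hcnt, hlen, hmap⟩ := h.chain_in hc
  have hsucc := succColour_getElem ch v hi
  have hrow := h.row v i hi
  set c := (ch.ord v)[i] with hcdef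
  have hb : s.arr 1 (lab.symm v) = lab.symm v * B := h.base _ (Fin.is_lt _)
  rw [length_encodeList lab, length_manPref hc, encodeList_manPref hc]
  simp only [emitMan, wp_block_cons, wp_assign, wp_emit, Expr.eval, Expr.cost, h0, h1, hb, hrow,
    hcnt, Function.update_self, ne_eq, Nat.reduceEqDiff, OfNat.zero_ne_ofNat, OfNat.one_ne_ofNat,
    not_false_eq_true, Function.update_of_ne]
  refine Wp.mono (Wp.frame (wp_emitChain (l := l) (by simpa using hl))) ?_
  rintro t s₁ ⟨⟨ht, hout⟩, hf⟩
  have harr : s₁.arr = s.arr := funext fun a =>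
    hf.arr a (by simp [emitChain, Program.block, Program.arrs])
  have g0 : s₁.reg 0 = lab.symm v := (hf.reg 0 (by decide)).trans (by simp [h0])
  have g1 : s₁.reg 1 = i := (hf.reg 1 (by decide)).trans (by simp [h1])
  have g8 : s₁.reg 8 = lab.symm v * B := (hf.reg 8 (by decide)).trans (by simp)
  simp only [ne_eq, Nat.reduceEqDiff, not_false_eq_true, Function.update_of_ne,
    Function.update_self, hmap] at hout
  by_cases hlast : i + 1 < (ch.ord v).length
  · refine wp_cond_true (by simp [Expr.eval, g0, g1, harr, h.len, hlast]) ?_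
    simp only [wp_emit, wp_block_nil, Expr.eval, Expr.cost, g0, g1, g8, harr, h.row v (i + 1) hlast,
      hout]
    refine ⟨by omega, ?_⟩
    simp [hsucc, Nat.mod_eq_of_lt hlast]
  · have hz : (i + 1) % (ch.ord v).length = 0 := by
      rw [show i + 1 = (ch.ord v).length by omega, Nat.mod_self]
    have h00 := h.row v 0 (by omega)
    rw [Nat.add_zero] at h00
    refine wp_cond_false (by simp [Expr.eval, g0, g1, harr, h.len, hlast]) ?_
    simp only [wp_emit, wp_block_nil, Expr.eval, Expr.cost, g0, g8, harr, h00, hout]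
    refine ⟨by omega, ?_⟩
    simp [hsucc, hz]

theorem wp_emitWoman (h : Tables lab ch B s.arr) {v : V} {i : ℕ} (hi : i < (ch.ord v).length)
    (h0 : s.reg 0 = lab.symm v) (h1 : s.reg 1 = i) :
    Wp emitWoman (fun t s' =>
      t ≤ 20 * (encodeList lab ((ch.ord v)[i], v)
        ((constructInstance lab ch).womanPref ((ch.ord v)[i], v))).length ∧
      s'.out = s.out ++ encodeList lab ((ch.ord v)[i], v)
        ((constructInstance lab ch).womanPref ((ch.ord v)[i], v))) s := by
  have hc : (ch.ord v)[i] ∈ ch.C v := (ch.mem_ord v _).1 (List.getElem_mem hi)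
  obtain ⟨l, hl, hcnt, hlen, hmap⟩ := h.chain_out hc
  -- The position of the cyclic predecessor.
  obtain ⟨j, hj, hji, hcase⟩ : ∃ j, ∃ hj : j < (ch.ord v).length,
      (j + 1) % (ch.ord v).length = i ∧ j = if i ≠ 0 then i - 1 else (ch.ord v).length - 1 := by
    by_cases h : i = 0
    · refine ⟨(ch.ord v).length - 1, by omega, ?_, by simp [h]⟩
      rw [Nat.sub_add_cancel (by omega), Nat.mod_self, h]
    · refine ⟨i - 1, by omega, ?_, by simp [h]⟩
      rw [Nat.sub_add_cancel (by omega), Nat.mod_eq_of_lt hi]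
  have hpred : (succColour ch v).symm (ch.ord v)[i] = (ch.ord v)[j] := by
    rw [Equiv.symm_apply_eq, succColour_getElem ch v hj]
    simp only [hji]
  have hrow := h.row v i hi
  have hrowj := h.row v j hj
  set c := (ch.ord v)[i] with hcdef
  have hb : s.arr 1 (lab.symm v) = lab.symm v * B := h.base _ (Fin.is_lt _)
  rw [length_encodeList lab, length_womanPref hc, encodeList_womanPref hc, hpred]
  simp only [emitWoman, wp_block_cons, wp_assign, wp_emit, Expr.eval, Expr.cost, h0, h1, hb, hrow,
    hcnt, Function.update_self, ne_eq, Nat.reduceEqDiff, OfNat.zero_ne_ofNat, OfNat.one_ne_ofNat,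
    not_false_eq_true, Function.update_of_ne]
  have hcond : ∀ {Q : ℕ → State → Prop} {s₁ : State}, s₁.reg 1 = i → s₁.reg 0 = lab.symm v →
      s₁.reg 8 = lab.symm v * B → s₁.arr = s.arr →
      (∀ t ≤ 20, Q t { s₁ with out := s₁.out ++ [((ch.ord v)[j] : ℕ)] }) →
      Wp (.cond (.reg 1) (.emit (.arr 3 (.add (.reg 8) (.sub (.reg 1) (.const 1)))))
        (.emit (.arr 3 (.add (.reg 8) (.sub (.arr 4 (.reg 0)) (.const 1)))))) Q s₁ := by
    intro Q s₁ g1 g0 g8 harr hQ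
    by_cases hi0 : i = 0
    · refine wp_cond_false (by simp [Expr.eval, g1, hi0]) ?_
      simp only [hi0, ne_eq, not_true_eq_false, if_false] at hcase
      simp only [wp_emit, Expr.eval, Expr.cost, g0, g8, harr, h.len, ← hcase, hrowj]
      rw [← harr]
      refine hQ _ ?_
      omega
    · refine wp_cond_true (by simp [Expr.eval, g1, hi0]) ?_
      simp only [hi0, ne_eq, not_false_eq_true, if_true] at hcase
      simp only [wp_emit, Expr.eval, Expr.cost, g1, g8, harr, ← hcase, hrowj]
      rw [← harr]
      refine hQ _ ?_
      omega
  refine hcond (by simp [h1]) (by simp [h0]) (by simp) rfl ?_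
  intro t₀ ht₀
  simp only [ne_eq, OfNat.zero_ne_ofNat, not_false_eq_true,
    Function.update_of_ne, Function.update_self, h0]
  refine Wp.mono (Wp.frame (wp_emitChain (l := l) (by simpa using hl))) ?_
  rintro t s₁ ⟨⟨ht, hout⟩, hf⟩
  have g0 : s₁.reg 0 = lab.symm v := (hf.reg 0 (by decide)).trans (by simp [h0])
  have g3 : s₁.reg 3 = c := (hf.reg 3 (by decide)).trans (by simp)
  simp only [ne_eq, Nat.reduceEqDiff, not_false_eq_true, Function.update_of_ne,
    Function.update_self, hmap] at hout
  simp only [wp_block_nil, g0, g3, hout]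
  refine ⟨by omega, ?_⟩
  simp

end Output

/-! ### The whole program -/

/-- The program that constructs the instance. -/
def constructProg : Program :=
  .block [boundProg, baseProg, colourProg, padProg, linkProg 5 2 (.reg 0),
    linkProg 8 3 (.sub (.arr 0 (.const 1)) (.add (.reg 0) (.const 1))),
    .emit (.reg 7), .emit (.reg 7), forAgents emitMan, forAgents emitWoman]

/-- The fibres of `f` over distinct elements are disjoint. -/
theorem sum_length_filter_le {α β : Type*} [DecidableEq β] {l : List β} (hl : l.Nodup)
    (es : List α) (f : α → β) :
    (l.map fun b => (es.filter fun e => f e = b).length).sum ≤ es.length := by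
  rw [← List.sum_toFinset _ hl]
  induction es with
  | nil => simp
  | cons e es ih =>
    have : ∀ b, ((e :: es).filter fun e => f e = b).length =
        (es.filter fun e => f e = b).length + if f e = b then 1 else 0 := by
      intro b
      by_cases h : f e = b <;> simp [h]
    simp only [this, Finset.sum_add_distrib, Finset.sum_ite_eq, List.length_cons]
    split_ifs <;> omega

section Main

variable {V : Type*} [PartialOrder V] {p : ℕ}

/-- The agents of either side, in the order in which they are written. -/
def agentList {φ : HasseEdge V → ℕ+} (lab : Fin p ≃ V) (ch : Choices φ) : List (Name V) :=
  (List.finRange p).flatMap fun i => (ch.ord (lab i)).map fun c => (c, lab i)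

section AgentList

variable {φ : HasseEdge V → ℕ+} (lab : Fin p ≃ V) (ch : Choices φ)

theorem mem_agentList {a : Name V} : a ∈ agentList lab ch ↔ a.1 ∈ ch.C a.2 := by
  obtain ⟨c, v⟩ := a
  simp only [agentList, List.mem_flatMap, List.mem_finRange, true_and, List.mem_map, Prod.mk.injEq,
    ch.mem_ord]
  constructor
  · rintro ⟨i, c, hc, rfl, rfl⟩; exact hc
  · intro h; exact ⟨lab.symm v, c, by simpa using h, rfl, by simp⟩

theorem agentList_nodup : (agentList lab ch).Nodup := by
  rw [agentList, List.nodup_flatMap]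
  refine ⟨fun i _ => (ch.ord_nodup _).map fun c d h => (Prod.mk.inj h).1, ?_⟩
  refine (List.nodup_finRange p).imp fun {i j} hij => ?_
  rw [Function.onFun, List.disjoint_left]
  simp only [List.mem_map]
  rintro _ ⟨c, -, rfl⟩ ⟨d, -, h⟩
  exact hij (lab.injective (Prod.mk.inj h).2.symm)

theorem length_agentList : (agentList lab ch).length = ∑ i, (ch.ord (lab i)).length := by
  simp [agentList, List.length_flatMap, Fin.sum_univ_def]

variable [DecidableEq V]

theorem length_agentList_le :
    (agentList lab ch).length ≤ 2 * (p + Nat.card (HasseEdge V)) := by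
  refine le_trans (le_of_eq ?_) (card_names_le lab ch)
  rw [← List.toFinset_card_of_nodup (agentList_nodup lab ch)]
  congr 1
  ext a
  rw [List.mem_toFinset, mem_agentList, mem_names]

theorem sum_le_of_agentList (n : Name V → ℕ) (f : HasseEdge V → Name V)
    (hn : ∀ a, a.1 ∈ ch.C a.2 → n a = 7 + 2 * (ch.edges.filter fun e => f e = a).length) :
    ((agentList lab ch).map n).sum ≤ 16 * (p + Nat.card (HasseEdge V)) := by
  have h1 : ((agentList lab ch).map n).sum = 7 * (agentList lab ch).length +
      2 * ((agentList lab ch).map fun a => (ch.edges.filter fun e => f e = a).length).sum := by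
    rw [List.map_congr_left fun a ha => hn a ((mem_agentList lab ch).1 ha)]
    generalize agentList lab ch = l
    induction l with
    | nil => rfl
    | cons a l ih => simp only [List.map_cons, List.sum_cons, List.length_cons, ih]; ring
  have h2 := sum_length_filter_le (agentList_nodup lab ch) ch.edges f
  have h3 := length_agentList_le lab ch
  have h4 := card_hasseEdge_eq_length ch.edges_nodup ch.mem_edges
  omega

theorem length_output_men_le : ((agentList lab ch).flatMap fun a =>
    encodeList lab a ((constructInstance lab ch).manPref a)).length ≤
      16 * (p + Nat.card (HasseEdge V)) := by
  rw [List.length_flatMap]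
  refine sum_le_of_agentList lab ch _ (fun e => (φ e, e.tgt)) ?_
  rintro ⟨c, v⟩ hc
  rw [length_encodeList, length_manPref hc, inEdges]
  simp only [Prod.mk.injEq, and_comm]
  ring

theorem length_output_women_le : ((agentList lab ch).flatMap fun a =>
    encodeList lab a ((constructInstance lab ch).womanPref a)).length ≤
      16 * (p + Nat.card (HasseEdge V)) := by
  rw [List.length_flatMap]
  refine sum_le_of_agentList lab ch _ (fun e => (φ e, e.src)) ?_
  rintro ⟨c, v⟩ hc
  rw [length_encodeList, length_womanPref hc, outEdges]
  simp only [Prod.mk.injEq, and_comm]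
  ring

end AgentList

/-- The choices made by the program, given the lists `L v` of the colours at the vertices. -/
def choicesOf {φ : HasseEdge V → ℕ+} {edges : List (HasseEdge V)} (hnd : edges.Nodup)
    (hall : ∀ e, e ∈ edges) {L : V → List ℕ+} (hL : ∀ v, (L v).Nodup)
    (hmem : ∀ v c, c ∈ L v ↔ c ∈ incidentColours φ v)
    (hpad : ∀ v, (padList (padList (L v) 1) 2).Nodup) : Choices φ :=
  have hset : ∀ v, incidentColours φ v = ((L v).toFinset : Set ℕ+) := fun v => by
    ext c; simp [hmem]
  have hcard : ∀ v, (incidentColours φ v).ncard = (L v).length := fun v => by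
    rw [hset, Set.ncard_coe_finset, List.toFinset_card_of_nodup (hL v)]
  { edges := edges
    edges_nodup := hnd
    mem_edges := hall
    C := fun v => (padList (padList (L v) 1) 2).toFinset
    C_eq := fun v h => by
      rw [hcard] at h
      rw [padList_of_two_le (l := L v) h, padList_of_two_le h, hset]
    C_pad := fun v h => by
      rw [hcard] at h
      obtain ⟨h1, h2, h3⟩ := padList_padList h
      refine ⟨fun c hc => ?_, fun c hc => ?_, ?_⟩
      · simpa using h2 c ((hmem v c).2 hc)
      · have := h3 c (by simpa using hc)
        rw [hmem] at this
        exact this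
      · rw [List.toFinset_card_of_nodup (hpad v), h1]
    ord := fun v => padList (padList (L v) 1) 2
    ord_nodup := hpad
    mem_ord := fun v c => by simp }

theorem flatMap_agentList {φ : HasseEdge V → ℕ+} (lab : Fin p ≃ V) (ch : Choices φ)
    (f : Name V → List ℕ) :
    ((List.finRange p).flatMap fun i => (ch.ord (lab i)).flatMap fun c => f (c, lab i)) =
      (agentList lab ch).flatMap f := by
  simp [agentList, List.flatMap_assoc, List.flatMap_map]

theorem constructProg_correct [DecidableEq V] (lab : Fin p ≃ V) (φ : HasseEdge V → ℕ+)
    (edges : List (HasseEdge V)) (hnd : edges.Nodup) (hall : ∀ e, e ∈ edges) :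
    ∃ (ch : Choices φ) (out : List ℕ), EncodesInstance lab (constructInstance lab ch) out ∧
      ComputesWithin constructProg (encodeInput lab φ edges) out
        (5000 * (p + edges.length + 1)) := by
  suffices hw : Wp constructProg (fun t s => ∃ ch : Choices φ,
      EncodesInstance lab (constructInstance lab ch) s.out ∧ t ≤ 5000 * (p + edges.length + 1))
      (initState (encodeInput lab φ edges)) by
    obtain ⟨t, s, hr, ch, henc, ht⟩ := hw
    exact ⟨ch, s.out, henc, t, s, hr, ht, rfl⟩
  set s₀ := initState (encodeInput lab φ edges) with hs₀
  have i0 : s₀.arr 0 = inputArr lab φ edges := rfl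
  have z0 : ∀ a, a ≠ 0 → ∀ i, s₀.arr a i = 0 := fun a ha i => if_neg ha
  rw [constructProg, wp_block_cons]
  refine Wp.mono (Wp.frame (wp_boundProg i0)) ?_
  rintro t₁ s₁ ⟨⟨ht₁, hB3, hB⟩, f₁⟩
  set B := s₁.reg 4 with hBdef
  have a₁ : s₁.arr = s₀.arr := funext fun a => f₁.arr a (by
    simp [boundProg, forLoop, Program.block, Program.arrs])
  have r₁ : s₁.reg 7 = 0 := f₁.reg 7 (by decide)
  have o₁ : s₁.out = [] := f₁.out (by decide)
  rw [wp_block_cons]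
  refine Wp.mono (Wp.frame (wp_baseProg (by rw [a₁]; exact i0))) ?_
  rintro t₂ s₂ ⟨⟨ht₂, hbase⟩, f₂⟩
  rw [← hBdef] at hbase
  have i₂ : s₂.arr 0 = inputArr lab φ edges := (f₂.arr 0 (by decide)).trans (by rw [a₁]; exact i0)
  have z₂ : ∀ a, 2 ≤ a → ∀ i, s₂.arr a i = 0 := fun a ha i => by
    rw [f₂.arr a ?_, a₁, z0 a (by omega)]
    simp only [baseProg, forLoop, Program.block, Program.arrs, List.append_nil, List.nil_append,
      List.mem_singleton]
    omega
  rw [wp_block_cons]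
  refine Wp.mono (Wp.frame (wp_colourProg i₂ hB hbase (z₂ 2 le_rfl) (z₂ 4 (by omega))
    ((f₂.reg 7 (by decide)).trans r₁))) ?_
  rintro t₃ s₃ ⟨⟨ht₃, L, hL, hmem⟩, f₃⟩
  have i₃ : s₃.arr 0 = inputArr lab φ edges := (f₃.arr 0 (by decide)).trans i₂
  rw [wp_block_cons]
  refine Wp.mono (Wp.frame (wp_padProg i₃ hB3 (by rw [f₃.arr 1 (by decide)]; exact hbase) hL)) ?_
  rintro t₄ s₄ ⟨⟨ht₄, hL'⟩, f₄⟩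
  have i₄ : s₄.arr 0 = inputArr lab φ edges := (f₄.arr 0 (by decide)).trans i₃
  have z₄ : ∀ a, 5 ≤ a → ∀ i, s₄.arr a i = 0 := fun a ha i => by
    rw [f₄.arr a ?_, f₃.arr a ?_, z₂ a (by omega)]
    · simp only [colourProg, addColour, forLoop, Program.block, Program.arrs, List.append_nil,
        List.nil_append, List.cons_append, List.mem_cons, List.not_mem_nil, or_false]
      omega
    · simp only [padProg, padColour, addColour, forLoop, Program.block, Program.arrs,
        List.append_nil, List.nil_append, List.cons_append, List.mem_cons, List.not_mem_nil,
        or_false]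
      omega
  rw [wp_block_cons]
  refine Wp.mono (Wp.frame (wp_linkProg (a := 5) (k := 2) (by omega) (idx := fun j => j)
    (done := fun j => (List.range j).reverse) i₄ (fun _ _ _ h => h) rfl
    (fun j _ => by simp [List.range_succ]) (fun j _ => by simp) z₄)) ?_
  rintro t₅ s₅ ⟨⟨ht₅, hout⟩, f₅⟩
  have i₅ : s₅.arr 0 = inputArr lab φ edges := (f₅.arr 0 (by decide)).trans i₄
  have z₅ : ∀ a, 8 ≤ a → ∀ i, s₅.arr a i = 0 := fun a ha i => by
    rw [f₅.arr a ?_, z₄ a (by omega)]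
    simp only [linkProg, linkEdge, forLoop, Program.block, Program.arrs, List.append_nil,
      List.nil_append, List.cons_append, List.mem_cons, List.not_mem_nil, or_false]
    omega
  rw [wp_block_cons]
  refine Wp.mono (Wp.frame (wp_linkProg (a := 8) (k := 3) (by omega)
    (idx := fun j => edges.length - (j + 1))
    (done := fun j => List.range' (edges.length - j) j) i₅ ?_ rfl ?_ ?_ z₅)) ?_
  · intro s' j h0 hj
    simp [Expr.eval, h0, i₅, inputArr_one, hj]
  · intro j hj
    rw [List.range'_succ, show edges.length - (j + 1) + 1 = edges.length - j by omega]
  · intro j hj h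
    rw [List.mem_range'_1] at h
    omega
  rintro t₆ s₆ ⟨⟨ht₆, hinn⟩, f₆⟩
  have hmem' : ∀ v c, c ∈ L v ↔ c ∈ incidentColours φ v := fun v c =>
    (hmem v c).trans ⟨fun ⟨e, _, h⟩ => ⟨e, h⟩, fun ⟨e, h⟩ => ⟨e, hall e, h⟩⟩
  let ch : Choices φ := choicesOf hnd hall hL.nodup hmem' hL'.nodup
  have hT : Tables lab ch B s₆.arr := by
    have e6 : ∀ a < 8, s₆.arr a = s₅.arr a := fun a ha => f₆.arr a (by
      simp only [linkProg, linkEdge, forLoop, Program.block, Program.arrs, List.append_nil,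
        List.nil_append, List.cons_append, List.mem_cons, List.not_mem_nil, or_false]
      omega)
    have e5 : ∀ a < 5, s₅.arr a = s₄.arr a := fun a ha => f₅.arr a (by
      simp only [linkProg, linkEdge, forLoop, Program.block, Program.arrs, List.append_nil,
        List.nil_append, List.cons_append, List.mem_cons, List.not_mem_nil, or_false]
      omega)
    have k5 : edgeKey s₆.arr 3 = edgeKey s₅.arr 3 := by
      funext e; simp only [edgeKey, e6 0 (by omega), e6 1 (by omega)]
    have k4 : edgeKey s₆.arr 2 = edgeKey s₄.arr 2 := by
      funext e; simp only [edgeKey, e6 0 (by omega), e6 1 (by omega), e5 0 (by omega),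
        e5 1 (by omega)]
    refine ⟨(e6 0 (by omega)).trans i₅, ?_, ?_, ?_, ?_, ?_, ?_⟩
    · rw [e6 1 (by omega), e5 1 (by omega), f₄.arr 1 (by decide), f₃.arr 1 (by decide)]
      exact hbase
    · rw [e6 4 (by omega), e5 4 (by omega)]
      exact hL'.len
    · rw [e6 3 (by omega), e5 3 (by omega)]
      exact hL'.row
    · intro v c hc
      exact hL'.lt v c ((ch.mem_ord v c).2 hc)
    · rw [k4]
      intro κ
      rw [e6 5 (by omega), e6 (5 + 1) (by omega), e6 (5 + 2) (by omega)]
      exact hout κ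
    · rw [k5]
      have := hinn
      rwa [Nat.sub_self, ← List.range_eq_range'] at this
  have h7 : s₆.reg 7 = (agentList lab ch).length := by
    rw [f₆.reg 7 (by decide), f₅.reg 7 (by decide), hL'.total, length_agentList]
    rfl
  have ho : s₆.out = [] := by
    rw [f₆.out (by decide), f₅.out (by decide), f₄.out (by decide), f₃.out (by decide),
      f₂.out (by decide), o₁]
  rw [wp_block_cons, wp_emit, wp_block_cons, wp_emit, wp_block_cons]
  refine Wp.mono (Wp.frame (wp_forAgents (ch := ch) (B := B) (P := emitMan)
    (G := fun c v => encodeList lab (c, v) ((constructInstance lab ch).manPref (c, v)))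
    hT rfl (by decide) (by decide) (fun s v i hi h h0 h1 => wp_emitMan h hi h0 h1)
    fun c v => by rw [length_encodeList]; omega)) ?_
  rintro t₇ s₇ ⟨⟨l₁, ho₁, hl₁, ht₇⟩, f₇⟩
  have a₇ : s₇.arr = s₆.arr := funext fun a => f₇.arr a (by
    rw [show (forAgents emitMan).arrs = [] from rfl]; simp)
  rw [wp_block_cons]
  refine Wp.mono (wp_forAgents (ch := ch) (B := B) (P := emitWoman)
    (G := fun c v => encodeList lab (c, v) ((constructInstance lab ch).womanPref (c, v)))
    (by rw [a₇]; exact hT) rfl (by decide) (by decide)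
    (fun s v i hi h h0 h1 => wp_emitWoman h hi h0 h1)
    fun c v => by rw [length_encodeList]; omega) ?_
  rintro t₈ s₈ ⟨l₂, ho₂, hl₂, ht₈⟩
  rw [flatMap_agentList lab ch fun a =>
    encodeList lab a ((constructInstance lab ch).manPref a)] at hl₁
  rw [flatMap_agentList lab ch fun a =>
    encodeList lab a ((constructInstance lab ch).womanPref a)] at hl₂
  have hlen₁ := length_output_men_le lab ch
  have hlen₂ := length_output_women_le lab ch
  rw [← hl₁] at hlen₁
  rw [← hl₂] at hlen₂
  have hq := card_hasseEdge_eq_length hnd hall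
  rw [wp_block_nil]
  refine ⟨ch, ⟨agentList lab ch, agentList lab ch, agentList_nodup lab ch, fun a => ?_,
    agentList_nodup lab ch, fun a => ?_, ?_⟩, ?_⟩
  · rw [mem_agentList, men_eq, mem_names]
  · rw [mem_agentList, women_eq, mem_names]
  · rw [ho₂, ho₁, hl₁, hl₂]
    simp [Expr.eval, ho, h7]
  · simp only [Expr.cost] at ht₅ ht₆ ⊢
    omega

end Main

end RotPoset

theorem mainTheorem1 :
    ∃ (K : ℕ) (P : RotPoset.Program),
      ∀ (V : Type*) [PartialOrder V] [DecidableEq V] (p q : ℕ) (lab : Fin p ≃ V)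
        (φ : RotPoset.HasseEdge V → ℕ+), Nat.card (RotPoset.HasseEdge V) = q →
        (∀ ch : RotPoset.Choices φ,
          (RotPoset.constructInstance lab ch).IsValid ∧
          (∃ f : ((· < ·) : V → V → Prop) ≃r (RotPoset.constructInstance lab ch).Precedes,
            ∀ v, (f v : Cycle (RotPoset.Name V × RotPoset.Name V)) = RotPoset.rho ch v) ∧
          (RotPoset.constructInstance lab ch).men.card +
            (RotPoset.constructInstance lab ch).women.card ≤ K * (p + q)) ∧
        (∀ edges : List (RotPoset.HasseEdge V), edges.Nodup → (∀ e, e ∈ edges) →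
          ∃ (ch : RotPoset.Choices φ) (out : List ℕ),
            RotPoset.EncodesInstance lab (RotPoset.constructInstance lab ch) out ∧
            RotPoset.ComputesWithin P (RotPoset.encodeInput lab φ edges) out
              (K * (p + q + 1))) := by
  refine ⟨5000, RotPoset.constructProg, ?_⟩
  intro V _ _ p q lab φ hq
  refine ⟨fun ch => ⟨RotPoset.isValid_constructInstance lab ch, RotPoset.exists_relIso lab ch, ?_⟩,
    fun edges hnd hall => ?_⟩
  · have := RotPoset.card_names_le lab ch
    rw [RotPoset.men_eq, RotPoset.women_eq]
    omega
  · rw [← hq, RotPoset.card_hasseEdge_eq_length hnd hall]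
    exact RotPoset.constructProg_correct lab φ edges hnd hall
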